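/- Let $1\le k<N$ be integers and let $w=(w_0,\dots,w_{N-1})$ be a vector of positive weights. Equip the space of complex $N\times N$ matrices with the weighted Frobenius norm $\|A\|^2=\sum_{j,l=0}^{N-1} w_j|A(j,l)|^2w_l$. Let $\mathcal{R}_{N,k}$ be the set of matrices of rank at most $k$, $\mathcal{H}_N$ the space of Hankel matrices $Hf=(f_{j+l})_{j,l=0}^{N-1}$, $f=(f_m)_{m=0}^{2N-2}\in\mathbb{C}^{2N-1}$, and $\mathcal{H}_{N,k}=\mathcal{R}_{N,k}\cap\mathcal{H}_N$. Let $\mathcal{H}^n_{N,k}$ be the set of $Hf\in\mathcal{H}_{N,k}$ whose upper left $k\times k$ submatrix is non-singular and for which the polynomial $x^k+\sum_{l<k}\lambda_lx^l$ determined by the recursion $f_{j+k}+\sum_{l<k}\lambda_lf_{j+l}=0$ $(0\le j\le 2N-2-k)$ has only simple, non-zero roots; $\mathcal{H}^n_{N,k}$ is a manifold (of real dimension $4k$). A set is called thin if it is contained in a finite union of (embedded smooth) manifolds of dimension lower than that of $\mathcal{H}^n_{N,k}$. For a set $S$ of matrices, $P_S(B)$ denotes the point of $S$ closest to $B$; it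 is well defined if there is exactly one such point. There is a thin subset $T$ of $\mathcal{H}_{N,k}$ such that for every $A\in\mathcal{H}_{N,k}\setminus T$ and every $\epsilon>0$ there is an $s>0$ such that the following holds for all $f$ with $\|Hf-A\|\le s$. The sequence of alternating projections $$B_0=Hf,\qquad B_{j+1}=\begin{cases}P_{\mathcal{R}_{N,k}}(B_j), & j\text{ even},\\ P_{\mathcal{H}_N}(B_j), & j \text{ odd},\end{cases}$$ and the best approximation $Hf_{opt}=P_{\mathcal{H}_{N,k}}(Hf)$ are well defined, and (i) $(B_j)$ converges to a point $Hf_\infty\in\mathcal{H}^n_{N,k}$; (ii) $\|Hf_\infty-Hf_{opt}\|\le\epsilon\,\|Hf-Hf_{opt}\|$. -/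

import Mathlib

open Filter Topology Polynomial
open scoped ContDiff

/-- `M` is an embedded smooth (`C^∞`) submanifold, without boundary, of real dimension `d` of the
finite-dimensional real vector space `V`: near each of its points it is the zero set of a smooth
map to `ℝ^c`, `d + c = dim V`, whose derivative at that point is onto. -/
def IsSubmanifold {V : Type*} [NormedAddCommGroup V] [NormedSpace ℝ V] [FiniteDimensional ℝ V]
    (d : ℕ) (M : Set V) : Prop :=
  ∃ c : ℕ, d + c = Module.finrank ℝ V ∧
    ∀ x ∈ M, ∃ (U : Set V) (g : V → (Fin c → ℝ)), IsOpen U ∧ x ∈ U ∧ ContDiffOn ℝ ∞ g U ∧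
      Function.Surjective (fderiv ℝ g x) ∧ M ∩ U = {y ∈ U | g y = 0}

/-- `E` is thin relatively to the manifold `M`: it is contained in the union of finitely many
manifolds of dimension lower than the dimension of `M`. -/
def IsThinRelativeTo {V : Type*} [NormedAddCommGroup V] [NormedSpace ℝ V] [FiniteDimensional ℝ V]
    (E M : Set V) : Prop :=
  ∃ D : ℕ, IsSubmanifold D M ∧
    ∃ (n : ℕ) (S : Fin n → Set V), (∀ i, ∃ d < D, IsSubmanifold d (S i)) ∧ E ⊆ ⋃ i, S i

-- The Frobenius norm makes the space of complex matrices a normed space.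
attribute [local instance] Matrix.frobeniusNormedAddCommGroup Matrix.frobeniusNormedSpace

/-- The Hankel matrix generated by `f`, with entries `f (j + l)`, `0 ≤ j, l ≤ N - 1`. -/
def hankel {N : ℕ} (f : Fin (2 * N - 1) → ℂ) : Matrix (Fin N) (Fin N) ℂ :=
  Matrix.of fun j l => f ⟨j.1 + l.1, by omega⟩

/-- The set `𝓗_N` of `N × N` Hankel matrices. -/
def hankelSet (N : ℕ) : Set (Matrix (Fin N) (Fin N) ℂ) :=
  {A | ∀ j l j' l' : Fin N, j.1 + l.1 = j'.1 + l'.1 → A j l = A j' l'}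

/-- The set `𝓡_{N,k}` of `N × N` matrices of rank at most `k`. -/
def rankSet (N k : ℕ) : Set (Matrix (Fin N) (Fin N) ℂ) :=
  {A | A.rank ≤ k}

/-- `P` is the monic polynomial `x^r + ∑_{l < r} λ_l x^l` whose coefficients give the recursion
`f (j + r) + ∑_{l < r} λ_l f (j + l) = 0` satisfied by the whole finite sequence `f`. -/
def IsCentralPolynomial {N : ℕ} (r : ℕ) (f : Fin (2 * N - 1) → ℂ) (P : ℂ[X]) : Prop :=
  P.Monic ∧ P.natDegree = r ∧
    ∀ (j : ℕ) (hj : j + r < 2 * N - 1),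
      ∑ l : Fin (r + 1), P.coeff l.1 * f ⟨j + l.1, by omega⟩ = 0

/-- The class `𝓗ⁿ_{N,r}`, `r < N`: Hankel matrices of rank at most `r` whose upper left corner
submatrix of order `r` is non-singular and whose central polynomial has only simple, non-zero
roots. -/
def genericHankelSet {N r : ℕ} (hr : r < N) : Set (Matrix (Fin N) (Fin N) ℂ) :=
  {A | A ∈ rankSet N r ∩ hankelSet N ∧
    (A.submatrix (Fin.castLE hr.le) (Fin.castLE hr.le)).det ≠ 0 ∧
    ∃ (f : Fin (2 * N - 1) → ℂ) (P : ℂ[X]), A = hankel f ∧ IsCentralPolynomial r f P ∧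
      ¬ P.IsRoot 0 ∧ P.roots.Nodup}

/-- The weighted Frobenius norm `‖A‖_w`. -/
noncomputable def weightedNorm {N : ℕ} (w : Fin N → ℝ) (A : Matrix (Fin N) (Fin N) ℂ) : ℝ :=
  Real.sqrt (∑ j, ∑ l, w j * ‖A j l‖ ^ 2 * w l)

/-- The projection onto `S` is well defined at `B`, with value `P`: the point `P` is the unique
point of `S` closest to `B` with respect to `‖·‖_w`. -/
def IsProjection {N : ℕ} (w : Fin N → ℝ) (S : Set (Matrix (Fin N) (Fin N) ℂ))
    (B P : Matrix (Fin N) (Fin N) ℂ) : Prop :=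
  P ∈ S ∧ ∀ Q ∈ S, Q ≠ P → weightedNorm w (B - P) < weightedNorm w (B - Q)

/-- `B` is the sequence of alternating projections that starts at `B₀`: first onto `𝓡_{N,k}`,
then onto `𝓗_N`, and so on, all projections being well defined. -/
def IsAlternatingProjectionSeq {N : ℕ} (w : Fin N → ℝ) (k : ℕ)
    (B₀ : Matrix (Fin N) (Fin N) ℂ) (B : ℕ → Matrix (Fin N) (Fin N) ℂ) : Prop :=
  B 0 = B₀ ∧ ∀ j,
    (Even j → IsProjection w (rankSet N k) (B j) (B (j + 1))) ∧
    (Odd j → IsProjection w (hankelSet N) (B j) (B (j + 1)))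

/-! The exceptional set `T` consists of the non-generic points of `rankSet N k ∩ hankelSet N`.

It is thin by a parameter count. Let `s ≤ k` be the largest order of a non-singular leading section
of such a Hankel matrix. The rank bound forces the recursion of length `s` to hold except at the
last `k - s` indices, so the first `2 * s` and the last `k - s` terms of the sequence determine the
matrix: `2 * (s + k)` real parameters, fewer than `4 * k` if `s < k`. If `s = k`, a multiple or zero
root means that a non-zero polynomial in the coordinates vanishes, and its zero set is covered by
finitely many manifolds of real codimension two (`exists_finset_regular_zeros`).

At a generic point `A` the convergence is local geometry. The matrices of rank at most `k` and those
which are also Hankel are images of smooth retractions near `A`, `skeleton` and `hankelChart ∘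
coordMap`. The intersection is clean: a Hankel direction tangent to the rank set is tangent to the
intersection (`fderiv_hankelChart_eq`). Modulo the common tangent space, the tangent space of the
rank set thus makes a positive angle with the Hankel space. To first order the nearest-point maps
are orthogonal projections onto tangent spaces, so one round of projections contracts the distance
to the intersection by a factor `κ < 1`, while the nearest point of the intersection moves by an
arbitrarily small fraction of that distance (`exists_contraction`). Summing a geometric series gives
convergence and the bound by `ε` (`alternatingProjections`). -/

/-! ### Nearest points of the image of a `C²` retraction. -/

section Abstract

set_option linter.unusedSectionVars false

variable {E : Type*} [NormedAddCommGroup E] [InnerProductSpace ℝ E]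

/-- `p` is a point of `S` closest to `b`. -/
def IsNearest (S : Set E) (b p : E) : Prop :=
  p ∈ S ∧ ∀ y ∈ S, ‖b - p‖ ≤ ‖b - y‖

/-- `p` is the only point of `S` closest to `b`. -/
def IsUniqueNearest (S : Set E) (b p : E) : Prop :=
  p ∈ S ∧ ∀ y ∈ S, y ≠ p → ‖b - p‖ < ‖b - y‖

/-- `r` is a `C²` retraction onto `S` near the point `a`. -/
structure IsLocalRetraction (r : E → E) (S : Set E) (a : E) : Prop where
  contDiffAt : ContDiffAt ℝ 2 r a
  mem : ∀ᶠ x in 𝓝 a, r x ∈ S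
  fix : ∀ᶠ x in 𝓝 a, x ∈ S → r x = x

theorem IsNearest.isUniqueNearest {S : Set E} {b p : E} (h : IsNearest S b p)
    (hu : ∀ q, IsNearest S b q → q = p) : IsUniqueNearest S b p := by
  refine ⟨h.1, fun y hy hne => lt_of_le_of_ne (h.2 y hy) fun heq => hne ?_⟩
  exact hu y ⟨hy, fun z hz => heq ▸ h.2 z hz⟩

theorem IsNearest.norm_sub_le {S : Set E} {a b p : E} (h : IsNearest S b p) (ha : a ∈ S) :
    ‖p - a‖ ≤ 2 * ‖b - a‖ := by
  have h1 := h.2 a ha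
  have h2 : p - a = (b - a) - (b - p) := by abel
  rw [h2]
  linarith [_root_.norm_sub_le (b - a) (b - p)]

theorem exists_isNearest [FiniteDimensional ℝ E] {S : Set E} (hS : IsClosed S) {a : E}
    (ha : a ∈ S) (b : E) : ∃ p, IsNearest S b p := by
  have : ProperSpace E := FiniteDimensional.proper ℝ E
  obtain ⟨p, hp, h⟩ := hS.exists_infDist_eq_dist ⟨a, ha⟩ b
  refine ⟨p, hp, fun y hy => ?_⟩
  rw [← dist_eq_norm, ← dist_eq_norm, ← h]
  exact Metric.infDist_le_dist_of_mem hy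

namespace IsLocalRetraction

variable {r : E → E} {S : Set E} {a : E}

theorem eventually_differentiableAt (h : IsLocalRetraction r S a) :
    ∀ᶠ x in 𝓝 a, DifferentiableAt ℝ r x := by
  filter_upwards [h.contDiffAt.eventually (by simp)] with x hx
  exact hx.differentiableAt (by simp)

theorem apply_self (h : IsLocalRetraction r S a) (ha : a ∈ S) : r a = a :=
  h.fix.self_of_nhds ha

theorem fderiv_idem (h : IsLocalRetraction r S a) (ha : a ∈ S) (v : E) :
    fderiv ℝ r a (fderiv ℝ r a v) = fderiv ℝ r a v := by
  have hd := h.eventually_differentiableAt.self_of_nhds.hasFDerivAt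
  have hra := h.apply_self ha
  have hd' : HasFDerivAt r (fderiv ℝ r a) (r a) := by rw [hra]; exact hd
  have h1 : HasFDerivAt (r ∘ r) ((fderiv ℝ r a).comp (fderiv ℝ r a)) a := hd'.comp a hd
  have hcont : Tendsto r (𝓝 a) (𝓝 a) := by
    have := hd.continuousAt.tendsto
    rwa [hra] at this
  have h2 : r ∘ r =ᶠ[𝓝 a] r := by
    filter_upwards [h.mem, hcont.eventually h.fix] with x hx hx2
    exact hx2 hx
  have h3 := (hd.congr_of_eventuallyEq h2).unique h1
  exact (DFunLike.congr_fun h3 v).symm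

theorem continuousAt_fderiv (h : IsLocalRetraction r S a) : ContinuousAt (fderiv ℝ r) a :=
  (h.contDiffAt.fderiv_right (m := 1) (by norm_num)).continuousAt

/-- First-order condition: `y ↦ ‖b - r y‖ ^ 2` has a local minimum at `x = r x`, since nearby values
of `r` lie in `S`. -/
theorem inner_fderiv_eq_zero (h : IsLocalRetraction r S a) :
    ∀ᶠ x in 𝓝 a, ∀ b, IsNearest S b x → ∀ v, inner ℝ (b - x) (fderiv ℝ r x v) = 0 := by
  filter_upwards [h.eventually_differentiableAt, h.mem.eventually_nhds, h.fix] with x hd hm hf b hb v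
  have hx := hf hb.1
  have h1 : HasFDerivAt (fun y => b - r y) (-(fderiv ℝ r x)) x := hd.hasFDerivAt.const_sub b
  have h2 := h1.norm_sq
  have hmin : IsLocalMin (fun y => ‖b - r y‖ ^ 2) x := by
    filter_upwards [hm] with y hy
    simp only [hx]
    exact pow_le_pow_left₀ (norm_nonneg _) (hb.2 _ hy) 2
  have h3 := hmin.hasFDerivAt_eq_zero h2
  have h4 := DFunLike.congr_fun h3 v
  rw [inner_sub_left]
  simp [hx] at h4
  linarith

/-- This is where `C²` enters: `fderiv ℝ r` is locally Lipschitz, so the mean value inequality on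
the segment has a quadratic error. -/
theorem exists_quadratic_bound (h : IsLocalRetraction r S a) :
    ∃ K : ℝ, 0 ≤ K ∧ ∃ ρ > 0, ∀ x ∈ Metric.ball a ρ, ∀ y ∈ Metric.ball a ρ, x ∈ S → y ∈ S →
      ‖y - x - fderiv ℝ r x (y - x)‖ ≤ K * ‖y - x‖ ^ 2 := by
  have h1 := h.contDiffAt.fderiv_right (m := 1) (by norm_num)
  obtain ⟨K, t, ht, hK⟩ := h1.exists_lipschitzOnWith
  obtain ⟨ρ, hρ, hball⟩ := Metric.mem_nhds_iff.1
    (inter_mem (inter_mem ht h.eventually_differentiableAt) h.fix)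
  refine ⟨K, K.2, ρ, hρ, fun x hx y hy hxS hyS => ?_⟩
  have hseg : segment ℝ x y ⊆ Metric.ball a ρ := (convex_ball a ρ).segment_subset hx hy
  have h2 := (convex_segment x y).norm_image_sub_le_of_norm_hasFDerivWithin_le' (𝕜 := ℝ)
    (f := r) (f' := fderiv ℝ r) (C := K * ‖y - x‖) (φ := fderiv ℝ r x)
    (fun z hz => ((hball (hseg hz)).1.2 : DifferentiableAt ℝ r z).hasFDerivAt.hasFDerivWithinAt)
    (fun z hz => by
      have h3 := hK.norm_sub_le (hball (hseg hz)).1.1 (hball hx).1.1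
      refine h3.trans ?_
      gcongr
      obtain ⟨t, ht0, ht1⟩ := (segment_eq_image' ℝ x y ▸ hz : z ∈ _ '' _)
      rw [← ht1]
      simp only [add_sub_cancel_left, norm_smul]
      have : ‖t‖ ≤ 1 := by rw [Real.norm_eq_abs, abs_le]; constructor <;> linarith [ht0.1, ht0.2]
      nlinarith [norm_nonneg (y - x)])
    (left_mem_segment ℝ x y) (right_mem_segment ℝ x y)
  rw [(hball hx).2 hxS, (hball hy).2 hyS] at h2
  linarith [h2, sq ‖y - x‖]

/-- For two nearest points, expanding `‖b - y‖ ^ 2 = ‖b - x‖ ^ 2` gives `‖y - x‖ ^ 2 = 2 * ⟪b - x, y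
- x⟫`. Only the normal part of `y - x` contributes, and it is quadratic in `‖y - x‖`. -/
theorem nearest_unique (h : IsLocalRetraction r S a) (ha : a ∈ S) :
    ∃ ρ > 0, ∀ b, ‖b - a‖ < ρ → ∀ x y, IsNearest S b x → IsNearest S b y → x = y := by
  obtain ⟨K, hK, ρ, hρ, hq⟩ := h.exists_quadratic_bound
  obtain ⟨ρ', hρ', hc⟩ := Metric.mem_nhds_iff.1 h.inner_fderiv_eq_zero
  -- The halves keep nearest points, which lie within `2 * ‖b - a‖` of `a`, in the good balls. The
  -- last term makes `‖b - x‖ * K ≤ 1 / 4`, whence `‖y - x‖ ^ 2 ≤ ‖y - x‖ ^ 2 / 2`.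
  refine ⟨min (min (ρ / 2) (ρ' / 2)) (1 / (4 * K + 4)), by positivity, fun b hb x y hx hy => ?_⟩
  have hb1 : ‖b - a‖ < ρ / 2 := hb.trans_le ((min_le_left _ _).trans (min_le_left _ _))
  have hb2 : ‖b - a‖ < ρ' / 2 := hb.trans_le ((min_le_left _ _).trans (min_le_right _ _))
  have hb3 : ‖b - a‖ < 1 / (4 * K + 4) := hb.trans_le (min_le_right _ _)
  have hxa := hx.norm_sub_le ha
  have hya := hy.norm_sub_le ha
  have h1 := hq x (by rw [mem_ball_iff_norm]; linarith) y (by rw [mem_ball_iff_norm]; linarith)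
    hx.1 hy.1
  have h2 := hc (show x ∈ Metric.ball a ρ' by rw [mem_ball_iff_norm]; linarith) b hx (y - x)
  have h3 : ‖b - y‖ = ‖b - x‖ := le_antisymm (hy.2 x hx.1) (hx.2 y hy.1)
  have h4 : ‖b - y‖ ^ 2 = ‖b - x‖ ^ 2 - 2 * inner ℝ (b - x) (y - x) + ‖y - x‖ ^ 2 := by
    rw [← norm_sub_sq_real]; congr 2; abel
  have h5 : inner ℝ (b - x) (y - x) = inner ℝ (b - x) (y - x - fderiv ℝ r x (y - x)) := by
    rw [inner_sub_right (b - x) (y - x) (fderiv ℝ r x (y - x)), h2, sub_zero]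
  have h6 := (real_inner_le_norm (b - x) (y - x - fderiv ℝ r x (y - x))).trans
    (mul_le_mul_of_nonneg_left h1 (norm_nonneg _))
  have h7 : ‖b - x‖ ≤ ‖b - a‖ := hx.2 a ha
  rw [h3] at h4
  have h8 : ‖y - x‖ ^ 2 ≤ 2 * (‖b - x‖ * K) * ‖y - x‖ ^ 2 := by nlinarith
  have h9 : ‖b - x‖ * K ≤ 1 / 4 := by
    calc ‖b - x‖ * K ≤ 1 / (4 * K + 4) * K := by gcongr; linarith
      _ ≤ 1 / 4 := by rw [div_mul_eq_mul_div, div_le_div_iff₀ (by positivity) (by norm_num)]; linarith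
  have h10 : ‖y - x‖ ^ 2 ≤ 0 := by nlinarith [sq_nonneg ‖y - x‖]
  have h11 : ‖y - x‖ = 0 := by nlinarith [sq_nonneg ‖y - x‖, norm_nonneg (y - x)]
  exact (sub_eq_zero.1 (norm_eq_zero.1 h11)).symm

variable [FiniteDimensional ℝ E]

/-- The tangent space at `a` of the set onto which `r` retracts. -/
noncomputable def tangent (r : E → E) (a : E) : Submodule ℝ E := (fderiv ℝ r a).range

theorem norm_sub_starProjection_le (K : Submodule ℝ E) (v w : E) (hw : w ∈ K) :
    ‖v - K.starProjection v‖ ≤ ‖v - w‖ := by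
  rw [K.starProjection_minimal v]
  exact ciInf_le ⟨0, by rintro _ ⟨y, rfl⟩; positivity⟩ (⟨w, hw⟩ : K)

theorem norm_starProjection_le (K : Submodule ℝ E) (v : E) : ‖K.starProjection v‖ ≤ ‖v‖ := by
  simpa using K.norm_starProjection_apply_le v

theorem mem_tangent_iff (h : IsLocalRetraction r S a) (ha : a ∈ S) {v : E} :
    v ∈ tangent r a ↔ fderiv ℝ r a v = v := by
  constructor
  · rintro ⟨w, rfl⟩
    exact h.fderiv_idem ha w
  · intro hv
    exact ⟨v, hv⟩

/-- Strict differentiability at `a`, with `r` fixing both endpoints, puts the chord close to its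
image under `fderiv ℝ r a`; the orthogonal projection is at least as close. -/
theorem eventually_chord (h : IsLocalRetraction r S a) {δ : ℝ} (hδ : 0 < δ) :
    ∃ ρ > 0, ∀ x y, ‖x - a‖ < ρ → ‖y - a‖ < ρ → x ∈ S → y ∈ S →
      ‖y - x - (tangent r a).starProjection (y - x)‖ ≤ δ * ‖y - x‖ := by
  have h1 := h.contDiffAt.hasStrictFDerivAt (by simp)
  have h2 := h1.isLittleO.def hδ
  have h3 : ∀ᶠ p : E × E in 𝓝 (a, a), ‖p.1 - p.2 - fderiv ℝ r a (p.1 - p.2)‖ ≤ δ * ‖p.1 - p.2‖ ∨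
      ¬ (p.1 ∈ S ∧ p.2 ∈ S) := by
    have e1 : ∀ᶠ p : E × E in 𝓝 (a, a), p.1 ∈ S → r p.1 = p.1 := by
      rw [nhds_prod_eq]; exact h.fix.prod_inl _
    have e2 : ∀ᶠ p : E × E in 𝓝 (a, a), p.2 ∈ S → r p.2 = p.2 := by
      rw [nhds_prod_eq]; exact h.fix.prod_inr _
    filter_upwards [h2, e1, e2] with p hp h1 h2
    by_cases hS : p.1 ∈ S ∧ p.2 ∈ S
    · left
      rwa [h1 hS.1, h2 hS.2] at hp
    · right; exact hS
  obtain ⟨ρ, hρ, hb⟩ := Metric.eventually_nhds_iff.1 h3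
  refine ⟨ρ, hρ, fun x y hx hy hxS hyS => ?_⟩
  have h4 := (@hb (y, x) (by
    rw [Prod.dist_eq, max_lt_iff]; exact ⟨by rwa [dist_eq_norm], by rwa [dist_eq_norm]⟩)).resolve_right
      (by simp [hxS, hyS])
  exact (norm_sub_starProjection_le _ _ _ (LinearMap.mem_range_self _ (y - x))).trans h4

/-- With `w` the tangential part of `b - x`, compare `⟪b - x, fderiv ℝ r x w⟫ = 0` with `fderiv ℝ r
a w = w`; the two derivatives are close. -/
theorem eventually_normal (h : IsLocalRetraction r S a) (ha : a ∈ S) {δ : ℝ} (hδ : 0 < δ) :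
    ∃ ρ > 0, ∀ x b, ‖x - a‖ < ρ → IsNearest S b x →
      ‖(tangent r a).starProjection (b - x)‖ ≤ δ * ‖b - x‖ := by
  have h1 : ∀ᶠ x in 𝓝 a, ‖fderiv ℝ r x - fderiv ℝ r a‖ < δ := by
    have := Metric.tendsto_nhds.1 h.continuousAt_fderiv.tendsto δ hδ
    simpa [dist_eq_norm] using this
  obtain ⟨ρ, hρ, hb⟩ := Metric.eventually_nhds_iff.1 (h1.and h.inner_fderiv_eq_zero)
  refine ⟨ρ, hρ, fun x b hx hxb => ?_⟩
  obtain ⟨h2, h3⟩ := @hb x (by rwa [dist_eq_norm])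
  set w := (tangent r a).starProjection (b - x) with hw
  have hwτ : w ∈ tangent r a := Submodule.starProjection_apply_mem _ _
  have hTw := (h.mem_tangent_iff ha).1 hwτ
  have h4 : inner ℝ (b - x) w = ‖w‖ ^ 2 := by
    have h5 : inner ℝ (b - x - w) w = 0 :=
      (tangent r a).starProjection_inner_eq_zero (b - x) w hwτ
    rw [inner_sub_left, real_inner_self_eq_norm_sq] at h5
    linarith
  have h6 : ‖w‖ ^ 2 = - inner ℝ (b - x) ((fderiv ℝ r x - fderiv ℝ r a) w) := by
    rw [sub_apply, inner_sub_right, h3 b hxb w, hTw, h4]; ring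
  have h7 : ‖w‖ ^ 2 ≤ ‖b - x‖ * (δ * ‖w‖) := by
    rw [h6]
    refine (neg_le_abs _).trans ((abs_real_inner_le_norm _ _).trans ?_)
    gcongr
    exact ((fderiv ℝ r x - fderiv ℝ r a).le_opNorm w).trans (by gcongr)
  rcases (norm_nonneg w).eq_or_lt with h0 | h0
  · rw [← h0]; positivity
  · nlinarith

/-- To first order the nearest-point map is the projection onto the tangent space: `q - x` is almost
tangent and `b - q` almost normal. -/
theorem nearest_approx (h : IsLocalRetraction r S a) (ha : a ∈ S) {δ : ℝ} (hδ : 0 < δ) :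
    ∃ ρ > 0, ∀ x b q, ‖x - a‖ < ρ → ‖b - a‖ < ρ → x ∈ S → IsNearest S b q →
      ‖q - x - (tangent r a).starProjection (b - x)‖ ≤ δ * ‖b - x‖ := by
  obtain ⟨ρ₁, hρ₁, h1⟩ := h.eventually_chord (δ := δ / 3) (by positivity)
  obtain ⟨ρ₂, hρ₂, h2⟩ := h.eventually_normal ha (δ := δ / 3) (by positivity)
  refine ⟨min (ρ₁ / 2) (ρ₂ / 2), by positivity, fun x b q hx hb hxS hq => ?_⟩
  have hb1 := hb.trans_le (min_le_left _ _)
  have hb2 := hb.trans_le (min_le_right _ _)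
  have hx1 := hx.trans_le (min_le_left _ _)
  have hqa := hq.norm_sub_le ha
  have e1 := h1 x q (by linarith) (by linarith) hxS hq.1
  have e2 := h2 q b (by linarith) hq
  have e3 := hq.2 x hxS
  have e4 := hq.norm_sub_le hxS
  set P := (tangent r a).starProjection
  have e5 : q - x - P (b - x) = (q - x - P (q - x)) - P (b - q) := by
    have : b - x = (b - q) + (q - x) := by abel
    rw [this, map_add]; abel
  rw [e5]
  refine (norm_sub_le _ _).trans ?_
  have : 0 ≤ ‖b - x‖ := norm_nonneg _
  nlinarith

end IsLocalRetraction

/-- A vector of `L` whose length is preserved by the projection lies in `τ ⊓ L`, hence is zero if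
also orthogonal to it. Compactness of the unit sphere turns the strict inequality into a uniform
one. -/
theorem exists_angle_bound [FiniteDimensional ℝ E] (τ L : Submodule ℝ E) :
    ∃ c : ℝ, 0 ≤ c ∧ c < 1 ∧ ∀ v ∈ L, v ∈ (τ ⊓ L)ᗮ → ‖τ.starProjection v‖ ≤ c * ‖v‖ := by
  have : ProperSpace E := FiniteDimensional.proper ℝ E
  let Q : Submodule ℝ E := L ⊓ (τ ⊓ L)ᗮ
  have hlt : ∀ v ∈ Q, v ≠ 0 → ‖τ.starProjection v‖ < ‖v‖ := by
    intro v hv hv0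
    refine lt_of_le_of_ne (IsLocalRetraction.norm_starProjection_le τ v) fun heq => hv0 ?_
    have hmem : v ∈ τ := by
      have h1 := τ.norm_sq_eq_add_norm_sq_starProjection v
      rw [heq] at h1
      have h2 : ‖τᗮ.starProjection v‖ = 0 := by nlinarith [norm_nonneg (τᗮ.starProjection v)]
      have h3 := τ.starProjection_add_starProjection_orthogonal v
      rw [norm_eq_zero.1 h2, add_zero] at h3
      rw [← h3]
      exact Submodule.starProjection_apply_mem _ _
    have := hv.2 v ⟨hmem, hv.1⟩
    exact inner_self_eq_zero.1 this
  have hcomp : IsCompact (Metric.sphere (0 : E) 1 ∩ Q) :=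
    (isCompact_sphere 0 1).inter_right Q.closed_of_finiteDimensional
  rcases (Metric.sphere (0 : E) 1 ∩ Q).eq_empty_or_nonempty with he | hne
  · refine ⟨0, le_rfl, one_pos, fun v hv hv' => ?_⟩
    by_cases hv0 : v = 0
    · simp [hv0]
    · exfalso
      have : (‖v‖⁻¹ • v) ∈ Metric.sphere (0 : E) 1 ∩ Q :=
        ⟨by simp [norm_smul, hv0], Q.smul_mem _ ⟨hv, hv'⟩⟩
      simp [he] at this
  · obtain ⟨u, hu, hmax⟩ := hcomp.exists_isMaxOn hne
      (f := fun v => ‖τ.starProjection v‖) (by fun_prop)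
    have hu1 : ‖u‖ = 1 := by simpa using hu.1
    refine ⟨‖τ.starProjection u‖, norm_nonneg _, ?_, fun v hv hv' => ?_⟩
    · have := hlt u hu.2 (by rintro rfl; simp at hu1)
      rwa [hu1] at this
    · by_cases hv0 : v = 0
      · simp [hv0]
      · have hm : (‖v‖⁻¹ • v) ∈ Metric.sphere (0 : E) 1 ∩ Q :=
          ⟨by simp [norm_smul, hv0], Q.smul_mem _ ⟨hv, hv'⟩⟩
        have h1 : ‖τ.starProjection (‖v‖⁻¹ • v)‖ ≤ ‖τ.starProjection u‖ := hmax hm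
        rw [map_smul, norm_smul, norm_inv, norm_norm] at h1
        have hpos : 0 < ‖v‖ := norm_pos_iff.2 hv0
        rwa [inv_mul_le_iff₀ hpos, mul_comm] at h1

end Abstract

/-! ### Alternating projections at a clean intersection with a subspace. -/

section AlternatingProjections

set_option linter.unusedSectionVars false

variable {E : Type*} [NormedAddCommGroup E] [InnerProductSpace ℝ E] [FiniteDimensional ℝ E]

open IsLocalRetraction

theorem starProjection_starProjection_of_le {K₁ K₂ : Submodule ℝ E} (h : K₁ ≤ K₂) (v : E) :
    K₁.starProjection (K₂.starProjection v) = K₁.starProjection v := by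
  have h1 : v - K₂.starProjection v ∈ K₁ᗮ :=
    Submodule.orthogonal_le h (K₂.sub_starProjection_mem_orthogonal v)
  have h2 := (Submodule.starProjection_apply_eq_zero_iff K₁).2 h1
  rw [map_sub, sub_eq_zero] at h2
  exact h2.symm

theorem starProjection_isUniqueNearest (L : Submodule ℝ E) (q : E) :
    IsUniqueNearest (L : Set E) q (L.starProjection q) := by
  refine ⟨Submodule.starProjection_apply_mem _ _, fun y hy hne => ?_⟩
  have h1 : ‖q - y‖ ^ 2 = ‖q - L.starProjection q‖ ^ 2 + ‖L.starProjection q - y‖ ^ 2 := by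
    have h2 : inner ℝ (q - L.starProjection q) (L.starProjection q - y) = 0 :=
      L.starProjection_inner_eq_zero q _ (L.sub_mem (Submodule.starProjection_apply_mem _ _) hy)
    have h3 : q - y = (q - L.starProjection q) + (L.starProjection q - y) := by abel
    rw [h3, norm_add_sq_real, h2]; ring
  have h4 : 0 < ‖L.starProjection q - y‖ := norm_pos_iff.2 (sub_ne_zero.2 hne.symm)
  exact lt_of_pow_lt_pow_left₀ 2 (norm_nonneg _) (by rw [h1]; linarith [pow_pos h4 2])

variable {R : Set E} {L : Submodule ℝ E} {a : E} {rR rS : E → E}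

/-- One inclusion is `htan`; the other follows by differentiating `rR ∘ rS = rS` and the vanishing
of the `Lᗮ`-part of `rS`. -/
theorem tangent_inter (haR : a ∈ R) (haL : a ∈ L) (hR : IsLocalRetraction rR R a)
    (hS : IsLocalRetraction rS (R ∩ L) a)
    (htan : ∀ h ∈ L, fderiv ℝ rR a h = h → fderiv ℝ rS a h = h) :
    tangent rS a = tangent rR a ⊓ L := by
  have hda := hS.eventually_differentiableAt.self_of_nhds.hasFDerivAt
  have hSa := hS.apply_self ⟨haR, haL⟩
  ext v
  rw [Submodule.mem_inf, hS.mem_tangent_iff ⟨haR, haL⟩, hR.mem_tangent_iff haR]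
  refine ⟨fun hv => ⟨?_, ?_⟩, fun hv => htan v hv.2 hv.1⟩
  · have hcont : Tendsto rS (𝓝 a) (𝓝 a) := by
      have := hda.continuousAt.tendsto
      rwa [hSa] at this
    have h2 : rR ∘ rS =ᶠ[𝓝 a] rS := by
      filter_upwards [hS.mem, hcont.eventually hR.fix] with x hx hx2
      exact hx2 hx.1
    have hdR : HasFDerivAt rR (fderiv ℝ rR a) (rS a) := by
      rw [hSa]; exact hR.eventually_differentiableAt.self_of_nhds.hasFDerivAt
    have h3 := (hda.congr_of_eventuallyEq h2).unique (hdR.comp a hda)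
    have h4 := DFunLike.congr_fun h3 v
    simp only [ContinuousLinearMap.comp_apply, hv] at h4
    exact h4.symm
  · have h1 : (Lᗮ.starProjection ∘ rS) =ᶠ[𝓝 a] fun _ => 0 := by
      filter_upwards [hS.mem] with x hx
      refine (Submodule.starProjection_apply_eq_zero_iff Lᗮ).2 ?_
      exact L.le_orthogonal_orthogonal hx.2
    have h2 := (hasFDerivAt_const (𝕜 := ℝ) (0 : E) a).congr_of_eventuallyEq h1
    have h3 := h2.unique (Lᗮ.starProjection.hasFDerivAt.comp a hda)
    have h4 := DFunLike.congr_fun h3 v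
    simp only [ContinuousLinearMap.comp_apply, hv] at h4
    have h5 := (Submodule.starProjection_apply_eq_zero_iff _).1 h4.symm
    rwa [Submodule.orthogonal_orthogonal] at h5

/-- The vector `b - p` is in `L` and almost normal to `R ∩ L`. Its projection to the tangent space
of `R` is therefore shorter by nearly the factor `c`, and its component along the common tangent
space, which governs `p' - p`, is negligible. -/
theorem exists_contraction (haR : a ∈ R) (haL : a ∈ L) (hR : IsLocalRetraction rR R a)
    (hS : IsLocalRetraction rS (R ∩ L) a)
    (htan : ∀ h ∈ L, fderiv ℝ rR a h = h → fderiv ℝ rS a h = h) :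
    ∃ κ : ℝ, 0 ≤ κ ∧ κ < 1 ∧ ∀ δ > 0, ∃ ρ > 0, ∀ b p q p', b ∈ L → ‖b - a‖ < ρ →
      IsNearest (R ∩ L) b p → IsNearest R b q → IsNearest (R ∩ L) (L.starProjection q) p' →
      ‖p' - p‖ ≤ δ * ‖b - p‖ ∧ ‖L.starProjection q - p'‖ ≤ κ * ‖b - p‖ := by
  obtain ⟨c, hc0, hc1, hc⟩ := exists_angle_bound (tangent rR a) L
  have hσ := tangent_inter haR haL hR hS htan
  refine ⟨(1 + c) / 2, by linarith, by linarith, fun δ hδ => ?_⟩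
  -- The drift of `p` accumulates the error `4 * δ'`; the contraction factor becomes `c + 2 * δ' ≤
  -- (1 + c) / 2`.
  set δ' := min (δ / 4) ((1 - c) / 4) with hδ'
  have hδ'0 : 0 < δ' := lt_min (by linarith) (by linarith)
  have hδ'1 : δ' ≤ δ / 4 := min_le_left _ _
  have hδ'2 : δ' ≤ (1 - c) / 4 := min_le_right _ _
  obtain ⟨ρ₁, hρ₁, h1⟩ := hR.nearest_approx haR hδ'0
  obtain ⟨ρ₂, hρ₂, h2⟩ := hS.eventually_normal ⟨haR, haL⟩ hδ'0
  obtain ⟨ρ₃, hρ₃, h3⟩ := hS.nearest_approx ⟨haR, haL⟩ hδ'0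
  refine ⟨min (min (ρ₁ / 2) (ρ₂ / 2)) (ρ₃ / 2), by positivity, ?_⟩
  intro b p q p' hbL hb hp hq hp'
  have hb1 : ‖b - a‖ < ρ₁ / 2 := hb.trans_le ((min_le_left _ _).trans (min_le_left _ _))
  have hb2 : ‖b - a‖ < ρ₂ / 2 := hb.trans_le ((min_le_left _ _).trans (min_le_right _ _))
  have hb3 : ‖b - a‖ < ρ₃ / 2 := hb.trans_le (min_le_right _ _)
  have hpa := hp.norm_sub_le (show a ∈ R ∩ L from ⟨haR, haL⟩)
  have hqa := hq.norm_sub_le haR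
  have hD : 0 ≤ ‖b - p‖ := norm_nonneg _
  have hca : ‖L.starProjection q - a‖ ≤ ‖q - a‖ := by
    have : L.starProjection q - a = L.starProjection (q - a) := by
      rw [map_sub, Submodule.starProjection_eq_self_iff.2 haL]
    rw [this]; exact norm_starProjection_le _ _
  have hcp : L.starProjection q - p = L.starProjection (q - p) := by
    rw [map_sub, Submodule.starProjection_eq_self_iff.2 hp.1.2]
  have hcp' : ‖L.starProjection q - p‖ ≤ ‖q - p‖ := by
    rw [hcp]; exact norm_starProjection_le _ _
  have e1 := h1 p b q (by linarith) (by linarith) hp.1.1 hq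
  have e2 := h2 p b (by linarith) hp
  have e3 := h3 p (L.starProjection q) p' (by linarith) (by linarith) hp.1 hp'
  have hqp := hq.norm_sub_le hp.1.1
  set D := ‖b - p‖
  set τ := tangent rR a
  have hστ : tangent rS a ≤ τ := hσ ▸ inf_le_left
  have hσL : tangent rS a ≤ L := hσ ▸ inf_le_right
  set σ := tangent rS a
  have e4 : ‖σ.starProjection (L.starProjection q - p)‖ ≤ 2 * δ' * D := by
    rw [hcp, starProjection_starProjection_of_le hσL]
    have : q - p = (q - p - τ.starProjection (b - p)) + τ.starProjection (b - p) := by abel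
    rw [this, map_add, starProjection_starProjection_of_le hστ]
    refine (norm_add_le _ _).trans ?_
    linarith [norm_starProjection_le σ (q - p - τ.starProjection (b - p))]
  have e5 : ‖p' - p‖ ≤ 4 * δ' * D := by
    have : p' - p = (p' - p - σ.starProjection (L.starProjection q - p))
      + σ.starProjection (L.starProjection q - p) := by abel
    rw [this]
    refine (norm_add_le _ _).trans ?_
    nlinarith
  refine ⟨by nlinarith, ?_⟩
  have e6 := hp'.2 p hp.1
  have e7 : ‖q - p‖ ≤ ‖τ.starProjection (b - p)‖ + δ' * D := by
    have : q - p = (q - p - τ.starProjection (b - p)) + τ.starProjection (b - p) := by abel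
    rw [this]
    refine (norm_add_le _ _).trans ?_
    linarith
  have hvL : b - p - σ.starProjection (b - p) ∈ L :=
    L.sub_mem (L.sub_mem hbL hp.1.2) (hσL (Submodule.starProjection_apply_mem _ _))
  have hvσ : b - p - σ.starProjection (b - p) ∈ (τ ⊓ L)ᗮ := by
    rw [← hσ]; exact Submodule.sub_starProjection_mem_orthogonal _
  have e8 := hc _ hvL hvσ
  have e9 : ‖b - p - σ.starProjection (b - p)‖ ≤ D := by
    simpa using norm_sub_starProjection_le σ (b - p) 0 σ.zero_mem
  have e10 : ‖τ.starProjection (b - p)‖ ≤ c * D + δ' * D := by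
    have : b - p = (b - p - σ.starProjection (b - p)) + σ.starProjection (b - p) := by abel
    rw [this, map_add]
    refine (norm_add_le _ _).trans ?_
    have := norm_starProjection_le τ (σ.starProjection (b - p))
    nlinarith
  nlinarith

theorem alternatingProjections (hRc : IsClosed R) (haR : a ∈ R) (haL : a ∈ L)
    (hR : IsLocalRetraction rR R a) (hS : IsLocalRetraction rS (R ∩ L) a)
    (htan : ∀ h ∈ L, fderiv ℝ rR a h = h → fderiv ℝ rS a h = h)
    {ε : ℝ} (hε : 0 < ε) {W : Set E} (hW : W ∈ 𝓝 a) :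
    ∃ s > 0, ∀ b ∈ L, ‖b - a‖ ≤ s → ∃ (B : ℕ → E) (p x : E), B 0 = b ∧
      (∀ j, (Even j → IsUniqueNearest R (B j) (B (j + 1))) ∧
        (Odd j → IsUniqueNearest (L : Set E) (B j) (B (j + 1)))) ∧
      IsUniqueNearest (R ∩ L) b p ∧ Tendsto B atTop (𝓝 x) ∧ x ∈ R ∩ L ∧ x ∈ W ∧
      ‖x - p‖ ≤ ε * ‖b - p‖ := by
  obtain ⟨κ, hκ0, hκ1, hκ⟩ := exists_contraction haR haL hR hS htan
  set m := min 1 ε with hm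
  have hm0 : 0 < m := lt_min one_pos hε
  have hm1 : m ≤ 1 := min_le_left _ _
  have hmε : m ≤ ε := min_le_right _ _
  -- The drift tolerance `m * (1 - κ)` makes the total drift, a geometric series of ratio `κ`, at
  -- most `m * D ≤ ε * D`.
  obtain ⟨ρ₁, hρ₁, hstep⟩ := hκ (m * (1 - κ)) (mul_pos hm0 (by linarith))
  obtain ⟨ρ₂, hρ₂, huR⟩ := hR.nearest_unique haR
  obtain ⟨ρ₃, hρ₃, huS⟩ := hS.nearest_unique ⟨haR, haL⟩
  obtain ⟨ρ₄, hρ₄, hball⟩ := Metric.mem_nhds_iff.1 hW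
  have hSc : IsClosed (R ∩ (L : Set E)) := hRc.inter L.closed_of_finiteDimensional
  have hmemS : a ∈ R ∩ (L : Set E) := ⟨haR, haL⟩
  choose nR hnR using fun b => exists_isNearest hRc haR b
  choose nS hnS using fun b => exists_isNearest hSc hmemS b
  set ρ := min (min ρ₁ ρ₂) (min ρ₃ ρ₄) with hρ
  have hρ0 : 0 < ρ := lt_min (lt_min hρ₁ hρ₂) (lt_min hρ₃ hρ₄)
  have hρle : ρ ≤ ρ₁ ∧ ρ ≤ ρ₂ ∧ ρ ≤ ρ₃ ∧ ρ ≤ ρ₄ :=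
    ⟨(min_le_left _ _).trans (min_le_left _ _), (min_le_left _ _).trans (min_le_right _ _),
      (min_le_right _ _).trans (min_le_left _ _), (min_le_right _ _).trans (min_le_right _ _)⟩
  -- All iterates then stay within `D + D + 2 * (ρ / 8) ≤ ρ / 2` of `a`.
  refine ⟨ρ / 8, by positivity, fun b hbL hb => ?_⟩
  let F : E → E := fun x => L.starProjection (nR x)
  let β : ℕ → E := fun j => F^[j] b
  have hβs : ∀ j, β (j + 1) = L.starProjection (nR (β j)) := fun j =>
    Function.iterate_succ_apply' F j b
  have hβ0 : β 0 = b := rfl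
  have hβL : ∀ j, β j ∈ L := by
    intro j
    cases j with
    | zero => exact hbL
    | succ j => rw [hβs]; exact Submodule.starProjection_apply_mem _ _
  set D := ‖b - nS b‖ with hD
  have hD0 : 0 ≤ D := norm_nonneg _
  have hDs : D ≤ ρ / 8 := ((hnS b).2 a hmemS).trans hb
  have hpa := (hnS b).norm_sub_le hmemS
  -- The second bound is the partial sum of the drifts. Together the two keep `β j` in the ball
  -- where `hstep` applies.
  have key : ∀ j, ‖β j - nS (β j)‖ ≤ κ ^ j * D ∧ ‖nS (β j) - nS b‖ ≤ m * (1 - κ ^ j) * D := by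
    intro j
    induction j with
    | zero => simp [hβ0, hD]
    | succ j ih =>
      have hk0 : 0 ≤ κ ^ j := pow_nonneg hκ0 j
      have hk1 : κ ^ j ≤ 1 := pow_le_one₀ hκ0 hκ1.le
      have hba : ‖β j - a‖ < ρ₁ := by
        have e1 : β j - a = (β j - nS (β j)) + (nS (β j) - nS b) + (nS b - a) := by abel
        have e2 := norm_add₃_le (a := β j - nS (β j)) (b := nS (β j) - nS b) (c := nS b - a)
        rw [← e1] at e2
        have e3 : κ ^ j * D ≤ D := by nlinarith
        have e4 : m * (1 - κ ^ j) * D ≤ D := by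
          have : m * (1 - κ ^ j) ≤ 1 := by nlinarith
          nlinarith
        linarith [ih.1, ih.2, hρle.1]
      obtain ⟨s1, s2⟩ := hstep (β j) (nS (β j)) (nR (β j)) (nS (β (j + 1))) (hβL j) hba
        (hnS _) (hnR _) (by rw [← hβs]; exact hnS _)
      rw [← hβs] at s2
      constructor
      · calc _ ≤ _ := s2
          _ ≤ κ * (κ ^ j * D) := by gcongr; exact ih.1
          _ = _ := by ring
      · have e1 : nS (β (j + 1)) - nS b = (nS (β (j + 1)) - nS (β j)) + (nS (β j) - nS b) := by abel
        rw [e1]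
        refine (norm_add_le _ _).trans ?_
        have e2 : m * (1 - κ) * ‖β j - nS (β j)‖ ≤ m * (1 - κ) * (κ ^ j * D) := by
          have : 0 ≤ m * (1 - κ) := mul_nonneg hm0.le (by linarith)
          gcongr; exact ih.1
        calc _ ≤ m * (1 - κ) * (κ ^ j * D) + m * (1 - κ ^ j) * D := by linarith [ih.2]
          _ = _ := by ring
  have hk0 : ∀ j, 0 ≤ κ ^ j := fun j => pow_nonneg hκ0 j
  have hk1 : ∀ j, κ ^ j ≤ 1 := fun j => pow_le_one₀ hκ0 hκ1.le
  have hp_le : ∀ j, ‖nS (β j) - nS b‖ ≤ m * D := fun j => by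
    refine (key j).2.trans ?_
    have : 0 ≤ m * κ ^ j * D := by have := hk0 j; positivity
    nlinarith
  have hmD : m * D ≤ D := by nlinarith
  have hba : ∀ j, ‖β j - a‖ < ρ := fun j => by
    have e1 : β j - a = (β j - nS (β j)) + (nS (β j) - nS b) + (nS b - a) := by abel
    have e2 := norm_add₃_le (a := β j - nS (β j)) (b := nS (β j) - nS b) (c := nS b - a)
    rw [← e1] at e2
    have e3 : κ ^ j * D ≤ D := by nlinarith [hk0 j, hk1 j]
    linarith [(key j).1, hp_le j]
  have hcau : CauchySeq fun j => nS (β j) := by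
    refine cauchySeq_of_le_geometric κ (m * (1 - κ) * D) hκ1 fun j => ?_
    obtain ⟨s1, -⟩ := hstep (β j) (nS (β j)) (nR (β j)) (nS (β (j + 1))) (hβL j)
      ((hba j).trans_le hρle.1) (hnS _) (hnR _) (by rw [← hβs]; exact hnS _)
    rw [dist_comm, dist_eq_norm]
    calc _ ≤ _ := s1
      _ ≤ m * (1 - κ) * (κ ^ j * D) := by
        have : 0 ≤ m * (1 - κ) := mul_nonneg hm0.le (by linarith)
        gcongr; exact (key j).1
      _ = _ := by ring
  have : CompleteSpace E := FiniteDimensional.complete ℝ E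
  obtain ⟨x, hx⟩ := cauchySeq_tendsto_of_complete hcau
  have hκlim : Tendsto (fun j => κ ^ j * D) atTop (𝓝 0) := by
    simpa using (tendsto_pow_atTop_nhds_zero_of_lt_one hκ0 hκ1).mul_const D
  have hβx : Tendsto β atTop (𝓝 x) := by
    have h0 : Tendsto (fun j => β j - nS (β j)) atTop (𝓝 0) :=
      squeeze_zero_norm (fun j => (key j).1) hκlim
    simpa using h0.add hx
  have hxS : x ∈ R ∩ (L : Set E) := hSc.mem_of_tendsto hx (Eventually.of_forall fun j => (hnS _).1)
  have hqx : Tendsto (fun j => nR (β j)) atTop (𝓝 x) := by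
    have h0 : Tendsto (fun j => nR (β j) - x) atTop (𝓝 0) := by
      refine squeeze_zero_norm (fun j => (hnR (β j)).norm_sub_le hxS.1) ?_
      have := (hβx.sub_const x).norm.const_mul 2
      simpa using this
    simpa using h0.add_const x
  have hxp : ‖x - nS b‖ ≤ m * D :=
    le_of_tendsto (hx.sub_const (nS b)).norm (Eventually.of_forall hp_le)
  -- `β` holds the even iterates, which lie in `L`; the odd ones are their nearest points in `R`.
  refine ⟨fun j => if Even j then β (j / 2) else nR (β (j / 2)), nS b, x, by simp [hβ0],
    fun j => ⟨fun hj => ?_, fun hj => ?_⟩, ?_, ?_, hxS, hball ?_, hxp.trans (by gcongr)⟩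
  · have h1 : ¬ Even (j + 1) := by rw [Nat.even_add_one]; simpa using hj
    have h2 : (j + 1) / 2 = j / 2 := by obtain ⟨i, rfl⟩ := hj; omega
    simp only [hj, h1, if_true, if_false, h2]
    exact (hnR _).isUniqueNearest fun q hq =>
      huR _ ((hba _).trans_le hρle.2.1) _ _ hq (hnR _)
  · have h0 : ¬ Even j := Nat.not_even_iff_odd.2 hj
    have h1 : Even (j + 1) := by rw [Nat.even_add_one]; exact h0
    have h2 : (j + 1) / 2 = j / 2 + 1 := by obtain ⟨i, rfl⟩ := hj; omega
    simp only [h0, h1, if_true, if_false, h2, hβs]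
    exact starProjection_isUniqueNearest _ _
  · exact (hnS b).isUniqueNearest fun q hq =>
      huS b ((hba 0).trans_le hρle.2.2.1) _ _ hq (hnS b)
  · have hdiv : Tendsto (fun j : ℕ => j / 2) atTop atTop :=
      Nat.tendsto_div_const_atTop (by norm_num)
    have h1 := hβx.comp hdiv
    have h2 := hqx.comp hdiv
    refine Metric.tendsto_nhds.2 fun η hη => ?_
    filter_upwards [Metric.tendsto_nhds.1 h1 η hη, Metric.tendsto_nhds.1 h2 η hη] with j hj1 hj2
    split_ifs
    · exact hj1
    · exact hj2
  · rw [mem_ball_iff_norm]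
    have e1 : x - a = (x - nS b) + (nS b - a) := by abel
    have e2 := norm_add_le (x - nS b) (nS b - a)
    rw [← e1] at e2
    linarith [hρle.2.2.2]

end AlternatingProjections

/-! ### Graphs over coordinates as submanifolds. -/

section Submanifolds

theorem isSubmanifold_graph {V F H : Type*} [NormedAddCommGroup V] [NormedSpace ℝ V]
    [FiniteDimensional ℝ V] [NormedAddCommGroup F] [NormedSpace ℝ F] [FiniteDimensional ℝ F]
    [NormedAddCommGroup H] [NormedSpace ℝ H] [FiniteDimensional ℝ H]
    (π : V →L[ℝ] F) (hπ : Function.Surjective π) (φ : F → V) (h : F → H) {O : Set F}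
    (hO : IsOpen O) (hφ : ContDiffOn ℝ ∞ φ O) (hh : ContDiffOn ℝ ∞ h O)
    (hsec : ∀ u ∈ O, π (φ u) = u)
    (hsub : ∀ u ∈ O, h u = 0 → Function.Surjective (fderiv ℝ h u)) {d : ℕ}
    (hd : d + Module.finrank ℝ H = Module.finrank ℝ F) :
    IsSubmanifold d {x | π x ∈ O ∧ φ (π x) = x ∧ h (π x) = 0} := by
  let K : Submodule ℝ V := π.ker
  obtain ⟨κ₀, hκ₀⟩ := K.subtype.exists_leftInverse_of_injective (by simp)
  let κ : V →L[ℝ] K := LinearMap.toContinuousLinearMap κ₀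
  have hκ : ∀ z : K, κ (z : V) = z := fun z => DFunLike.congr_fun hκ₀ z
  have hrk : Module.finrank ℝ F + Module.finrank ℝ K = Module.finrank ℝ V := by
    have h1 := (π : V →ₗ[ℝ] F).finrank_range_add_finrank_ker
    rw [LinearMap.range_eq_top.2 hπ, finrank_top] at h1
    exact h1
  let c := Module.finrank ℝ (K × H)
  have hc : c = Module.finrank ℝ K + Module.finrank ℝ H := Module.finrank_prod
  let e : (K × H) ≃L[ℝ] (Fin c → ℝ) :=
    ContinuousLinearEquiv.ofFinrankEq (by simp [c])
  refine ⟨c, by omega, fun x hx => ?_⟩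
  -- The defect `y - φ (π y)` lies in the kernel of `π`, so the projection `κ` onto that kernel
  -- detects it with the right number of equations.
  let G : V → K × H := fun y => (κ (y - φ (π y)), h (π y))
  have hU : IsOpen (π ⁻¹' O) := hO.preimage π.continuous
  have hφπ : ContDiffOn ℝ ∞ (fun y => φ (π y)) (π ⁻¹' O) :=
    hφ.comp π.contDiff.contDiffOn fun y hy => hy
  have hhπ : ContDiffOn ℝ ∞ (fun y => h (π y)) (π ⁻¹' O) :=
    hh.comp π.contDiff.contDiffOn fun y hy => hy
  have hG : ContDiffOn ℝ ∞ G (π ⁻¹' O) :=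
    (κ.contDiff.comp_contDiffOn (contDiffOn_id.sub hφπ)).prodMk hhπ
  refine ⟨π ⁻¹' O, fun y => e (G y), hU, hx.1, e.contDiff.comp_contDiffOn hG, ?_, ?_⟩
  · have dφ := ((hφ.contDiffAt (hO.mem_nhds hx.1)).differentiableAt (by simp)).hasFDerivAt
    have dh := ((hh.contDiffAt (hO.mem_nhds hx.1)).differentiableAt (by simp)).hasFDerivAt
    have dφπ : HasFDerivAt (fun y => φ (π y)) ((fderiv ℝ φ (π x)).comp π) x :=
      dφ.comp x π.hasFDerivAt
    have dhπ : HasFDerivAt (fun y => h (π y)) ((fderiv ℝ h (π x)).comp π) x :=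
      dh.comp x π.hasFDerivAt
    have dG := ((κ.hasFDerivAt.comp x ((hasFDerivAt_id x).sub dφπ))).prodMk dhπ
    have deG := e.hasFDerivAt.comp x dG
    have heq := deG.fderiv
    have dsec : ∀ u, π (fderiv ℝ φ (π x) u) = u := by
      have h1 : (fun u => π (φ u)) =ᶠ[𝓝 (π x)] id := by
        filter_upwards [hO.mem_nhds hx.1] with u hu using hsec u hu
      have h2 := ((hasFDerivAt_id (𝕜 := ℝ) (π x)).congr_of_eventuallyEq h1).unique
        (π.hasFDerivAt.comp (π x) dφ)
      exact fun u => (DFunLike.congr_fun h2 u).symm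
    change Function.Surjective (fderiv ℝ (e ∘ G) x)
    intro y
    obtain ⟨⟨z, w⟩, rfl⟩ := e.surjective y
    obtain ⟨u, hu⟩ := hsub _ hx.1 hx.2.2 w
    -- Directions along the graph leave the first component unchanged; directions in the kernel
    -- leave the second unchanged.
    refine ⟨fderiv ℝ φ (π x) u + z, ?_⟩
    have hz : π (z : V) = 0 := z.2
    have h3 : fderiv ℝ (e ∘ G) x = _ := heq
    rw [h3]
    simp [dsec, hz, hu, hκ]
  · ext y
    simp only [Set.mem_inter_iff, Set.mem_ofPred_eq, Set.mem_preimage]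
    constructor
    · rintro ⟨⟨h1, h2, h3⟩, -⟩
      refine ⟨h1, ?_⟩
      simp [G, h2, h3]
    · rintro ⟨h1, h2⟩
      have h3 : G y = 0 := by simpa using h2
      have h4 : κ (y - φ (π y)) = 0 := congrArg Prod.fst h3
      have h5 : y - φ (π y) ∈ K := by
        change π (y - φ (π y)) = 0
        rw [map_sub, hsec _ h1, sub_self]
      have h6 := hκ ⟨_, h5⟩
      rw [h4] at h6
      refine ⟨⟨h1, ?_, congrArg Prod.snd h3⟩, h1⟩
      exact (sub_eq_zero.1 (congrArg Subtype.val h6).symm).symm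

end Submanifolds

/-! ### Zero sets of complex polynomials. -/

namespace MvPolynomial

theorem hasFDerivAt_eval {n : ℕ} (p : MvPolynomial (Fin n) ℂ) (x : Fin n → ℂ) :
    HasFDerivAt (fun y => eval y p)
      (∑ i, eval x (pderiv i p) • (ContinuousLinearMap.proj i : (Fin n → ℂ) →L[ℂ] ℂ)) x := by
  induction p using MvPolynomial.induction_on with
  | C a =>
    simp only [eval_C]
    refine (hasFDerivAt_const (𝕜 := ℂ) a x).congr_fderiv ?_
    ext v
    simp
  | add p q hp hq =>
    simp only [map_add]
    refine (hp.add hq).congr_fderiv ?_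
    ext v
    simp [add_mul, Finset.sum_add_distrib]
  | mul_X p j hp =>
    have h := hp.mul (ContinuousLinearMap.proj (R := ℂ) (φ := fun _ : Fin n => ℂ) j).hasFDerivAt
    simp only [map_mul, eval_X]
    refine h.congr_fderiv ?_
    ext v
    have h1 : ∀ i, eval x (pderiv i (p * X j)) * v i =
        x j * (eval x (pderiv i p) * v i) + if j = i then eval x p * v i else 0 := fun i => by
      rw [Derivation.leibniz, pderiv_X, Pi.single_apply]
      split_ifs <;> simp <;> ring
    simp [-Derivation.leibniz, h1, Finset.sum_add_distrib, Finset.mul_sum, add_comm]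

theorem contDiff_eval {n : ℕ} (p : MvPolynomial (Fin n) ℂ) :
    ContDiff ℝ ∞ (fun y : Fin n → ℂ => eval y p) := by
  have h : ContDiff ℂ ∞ (fun y : Fin n → ℂ => eval y p) :=
    contDiffOn_univ.1 (AnalyticOnNhd.eval_mvPolynomial p).contDiffOn_of_completeSpace
  exact h.restrict_scalars ℝ

theorem surjective_fderiv_eval {n : ℕ} {p : MvPolynomial (Fin n) ℂ} {x : Fin n → ℂ} {i : Fin n}
    (h : eval x (pderiv i p) ≠ 0) :
    Function.Surjective (fderiv ℝ (fun y => eval y p) x) := by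
  rw [((hasFDerivAt_eval p x).restrictScalars ℝ).fderiv]
  intro c
  refine ⟨Pi.single i (c / eval x (pderiv i p)), ?_⟩
  simp [Pi.single_apply]
  field_simp

theorem totalDegree_pderiv_lt {n : ℕ} {p : MvPolynomial (Fin n) ℂ} {i : Fin n}
    (h : pderiv i p ≠ 0) : (pderiv i p).totalDegree < p.totalDegree := by
  classical
  obtain ⟨m, hm, hmd⟩ : ∃ m ∈ (pderiv i p).support, (pderiv i p).totalDegree = m.degree := by
    obtain ⟨m, hm, h⟩ :=
      Finset.exists_mem_eq_sup _ (support_nonempty.2 h) (fun s => s.sum fun _ e => e)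
    exact ⟨m, hm, h⟩
  have h1 : m + Finsupp.single i 1 ∈ p.support := by
    rw [mem_support_iff] at hm ⊢
    rw [coeff_pderiv] at hm
    exact left_ne_zero_of_mul hm
  have h2 := le_totalDegree h1
  have h3 : (m + Finsupp.single i 1).degree = m.degree + 1 := by simp [map_add]
  rw [Finsupp.degree_eq_sum] at h3
  rw [Finsupp.sum_fintype _ _ (by simp)] at h2
  omega

theorem exists_pderiv_ne_zero {n : ℕ} {p : MvPolynomial (Fin n) ℂ} (h : ∀ c, p ≠ C c) :
    ∃ i, pderiv i p ≠ 0 := by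
  by_contra! hall
  apply h (coeff 0 p)
  ext m
  rw [coeff_C]
  split_ifs with hm
  · rw [hm]
  · obtain ⟨i, hi⟩ : ∃ i, m i ≠ 0 := by
      by_contra! h0
      exact hm (Finsupp.ext fun i => (h0 i).symm)
    have h1 := coeff_pderiv (i := i) p (m - Finsupp.single i 1)
    have h2 : m - Finsupp.single i 1 + Finsupp.single i 1 = m := by
      refine tsub_add_cancel_of_le ?_
      rw [Finsupp.single_le_iff]; omega
    rw [hall i, h2] at h1
    simp only [coeff_zero] at h1
    refine (mul_eq_zero.1 h1.symm).resolve_right ?_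
    exact Nat.cast_add_one_ne_zero _

/-- Induction on the degree: where a non-zero partial derivative of `p` does not vanish the zero is
regular; elsewhere it is a zero of that derivative, which has lower degree. -/
theorem exists_finset_regular_zeros {n : ℕ} (p : MvPolynomial (Fin n) ℂ) (hp : p ≠ 0) :
    ∃ s : Finset (MvPolynomial (Fin n) ℂ × Fin n), ∀ x, eval x p = 0 →
      ∃ q ∈ s, eval x q.1 = 0 ∧ eval x (pderiv q.2 q.1) ≠ 0 := by
  classical
  induction hd : p.totalDegree using Nat.strong_induction_on generalizing p with
  | _ d ih =>
    subst hd
    by_cases hc : ∃ c, p = C c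
    · obtain ⟨c, rfl⟩ := hc
      refine ⟨∅, fun x hx => ?_⟩
      rw [eval_C] at hx
      simp [hx] at hp
    · obtain ⟨i, hi⟩ := exists_pderiv_ne_zero (not_exists.1 hc)
      obtain ⟨s, hs⟩ := ih _ (totalDegree_pderiv_lt hi) _ hi rfl
      refine ⟨insert (p, i) s, fun x hx => ?_⟩
      by_cases h0 : eval x (pderiv i p) = 0
      · obtain ⟨q, hq, h⟩ := hs x h0
        exact ⟨q, Finset.mem_insert_of_mem hq, h⟩
      · exact ⟨(p, i), Finset.mem_insert_self _ _, hx, h0⟩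

end MvPolynomial

/-! ### Rank and recursions of Hankel matrices. -/

section HankelAlgebra

/-- The `n × n` Hankel matrix of an infinite sequence. -/
def hankelMat {R : Type*} (n : ℕ) (g : ℕ → R) : Matrix (Fin n) (Fin n) R :=
  Matrix.of fun j l => g (j.1 + l.1)

@[simp] theorem hankelMat_apply {R : Type*} (n : ℕ) (g : ℕ → R) (j l : Fin n) :
    hankelMat n g j l = g (j.1 + l.1) := rfl

/-- The value of the recursion with coefficients `c` at the index `j` of the sequence `g`. -/
def recursionDefect {s : ℕ} (g : ℕ → ℂ) (c : Fin s → ℂ) (j : ℕ) : ℂ :=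
  g (j + s) + ∑ l : Fin s, c l * g (j + l.1)

/-- Applying the recursion to `t` columns gives columns of defects, which vanish above the
antidiagonal `j + i = n - 1` and equal the defect at `m` on it. With the first `s` columns they are
independent. -/
theorem le_rank_hankelMat {n s t m i₀ : ℕ} (g : ℕ → ℂ) (c : Fin s → ℂ)
    (hdet : (hankelMat s g).det ≠ 0) (h0 : ∀ j < m, recursionDefect g c j = 0)
    (hm : recursionDefect g c m ≠ 0) (h1 : i₀ + t + s = n) (h2 : m + 1 = n + i₀) :
    s + t ≤ (hankelMat n g).rank := by
  let col : Fin n → (Fin n → ℂ) := fun x j => g (j.1 + x.1)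
  have hcol : ∀ x, col x ∈ (hankelMat n g).mulVecLin.range := fun x =>
    ⟨Pi.single x 1, by ext j; simp [col]⟩
  let v : Fin s ⊕ Fin t → (Fin n → ℂ) := Sum.elim (fun i => col ⟨i.1, by omega⟩)
    (fun i j => recursionDefect g c (j.1 + i₀ + i.1))
  have hv : ∀ x, v x ∈ (hankelMat n g).mulVecLin.range := by
    rintro (i | i)
    · exact hcol _
    · have : v (Sum.inr i) = col ⟨i₀ + i.1 + s, by omega⟩ +
          ∑ l : Fin s, c l • col ⟨i₀ + i.1 + l.1, by omega⟩ := by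
        ext j
        simp [v, col, recursionDefect, add_assoc]
      rw [this]
      exact Submodule.add_mem _ (hcol _)
        (Submodule.sum_mem _ fun l _ => Submodule.smul_mem _ _ (hcol _))
  have hli : LinearIndependent ℂ v := by
    rw [Fintype.linearIndependent_iff]
    intro a ha
    have hj : ∀ j : Fin n, ∑ i : Fin s, a (Sum.inl i) * g (j.1 + i.1) +
        ∑ i : Fin t, a (Sum.inr i) * recursionDefect g c (j.1 + i₀ + i.1) = 0 := fun j => by
      have := congrFun ha j
      simpa [Fintype.sum_sum_type, v, col] using this
    -- In the first `s` rows all the defects have index below `m`, so only the non-singular block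
    -- remains.
    have hb : ∀ i, a (Sum.inl i) = 0 := by
      have h3 : (hankelMat s g).mulVec (fun i => a (Sum.inl i)) = 0 := by
        ext j
        have h4 := hj ⟨j.1, by omega⟩
        rw [Finset.sum_eq_zero (s := Finset.univ) (f := fun i : Fin t =>
          a (Sum.inr i) * recursionDefect g c (j.1 + i₀ + i.1))
          (fun i _ => by rw [h0 _ (by omega), mul_zero]), add_zero] at h4
        simpa [Matrix.mulVec, dotProduct, mul_comm] using h4
      exact fun i => congrFun (Matrix.eq_zero_of_mulVec_eq_zero hdet h3) i
    -- Triangular elimination, from the last defect column backwards.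
    have hc : ∀ q : ℕ, ∀ i : Fin t, t ≤ i.1 + q → a (Sum.inr i) = 0 := by
      intro q
      induction q with
      | zero => intro i hi; omega
      | succ q ih =>
        intro i hi
        have h4 := hj ⟨m - i₀ - i.1, by omega⟩
        simp only [hb, zero_mul, Finset.sum_const_zero, zero_add] at h4
        rw [Finset.sum_eq_single i] at h4
        · have h5 : m - i₀ - i.1 + i₀ + i.1 = m := by omega
          rw [h5] at h4
          exact (mul_eq_zero.1 h4).resolve_right hm
        · intro i' _ hne
          rcases lt_or_gt_of_ne (fun h => hne (Fin.ext h) : i'.1 ≠ i.1) with hlt | hgt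
          · rw [h0 _ (by omega), mul_zero]
          · rw [ih i' (by omega), zero_mul]
        · simp
    rintro (i | i)
    · exact hb i
    · exact hc t i (by omega)
  have hli' : LinearIndependent ℂ (fun x => (⟨v x, hv x⟩ : (hankelMat n g).mulVecLin.range)) :=
    LinearIndependent.of_comp (hankelMat n g).mulVecLin.range.subtype hli
  have := hli'.fintype_card_le_finrank
  simpa [Matrix.rank] using this

theorem rank_hankelMat_mono {n N : ℕ} (h : n ≤ N) (g : ℕ → ℂ) :
    (hankelMat n g).rank ≤ (hankelMat N g).rank := by
  have : hankelMat n g = (hankelMat N g).submatrix (Fin.castLE h) (Fin.castLE h) := by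
    ext; simp
  rw [this]
  have h1 := Matrix.eRank_submatrix_le (hankelMat N g) (Fin.castLE h) (Fin.castLE h)
  rw [← Matrix.eRank_toNat_eq_rank, ← Matrix.eRank_toNat_eq_rank (A := hankelMat N g)]
  exact ENat.toNat_le_toNat h1
    (ne_top_of_le_ne_top (ENat.natCast_ne_top N) (by simpa using (hankelMat N g).eRank_le_card_width))

/-- If a Hankel matrix of rank at most `k` has a non-singular leading section of order `s ≤ k`, and
singular ones of the orders between `s` and `k`, then the recursion of length `s` determined by
that section breaks only at the last `k - s` indices. -/
theorem recursionDefect_eq_zero {N s k : ℕ} (hsk : s ≤ k) (g : ℕ → ℂ)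
    (c : Fin s → ℂ) (hdet : (hankelMat s g).det ≠ 0)
    (hsing : ∀ n, s < n → n ≤ k → (hankelMat n g).det = 0)
    (hrank : (hankelMat N g).rank ≤ k) (hc : ∀ j < s, recursionDefect g c j = 0)
    (j : ℕ) (hj : j + k < 2 * N - 1) : recursionDefect g c j = 0 := by
  induction j using Nat.strong_induction_on with
  | _ m ih =>
    by_contra hm
    have hsm : s ≤ m := by
      by_contra h
      exact hm (hc m (by omega))
    have h0 : ∀ j < m, recursionDefect g c j = 0 := fun j hjm => ih j hjm (by omega)
    -- At a first failure `m`, the section of order `m + 1` is non-singular if it fits, against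
    -- `hsing` or `hrank`. Otherwise the whole matrix has rank at least `2 * N - m - 1 > k`.
    by_cases hmN : m + 1 ≤ N
    · have h1 := le_rank_hankelMat (n := m + 1) (t := m + 1 - s) (i₀ := 0) g c hdet h0 hm
        (by omega) (by omega)
      by_cases hmk : m + 1 ≤ k
      · have h2 := hsing (m + 1) (by omega) hmk
        obtain ⟨v, hv0, hv⟩ := Matrix.exists_mulVec_eq_zero_iff.2 h2
        have h3 := (hankelMat (m + 1) g).mulVecLin.finrank_range_add_finrank_ker
        have h4 : 0 < Module.finrank ℂ (hankelMat (m + 1) g).mulVecLin.ker :=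
          Module.finrank_pos_iff_exists_ne_zero.2 ⟨⟨v, hv⟩, fun h => hv0 (congrArg Subtype.val h)⟩
        have h5 : (hankelMat (m + 1) g).rank =
          Module.finrank ℂ (hankelMat (m + 1) g).mulVecLin.range := rfl
        simp only [Module.finrank_fin_fun] at h3
        omega
      · have := rank_hankelMat_mono hmN g
        omega
    · have h1 := le_rank_hankelMat (n := N) (t := 2 * N - s - m - 1) (i₀ := m + 1 - N) g c hdet h0
        hm (by omega) (by omega)
      omega

/-- The numerators of the coefficients of the recursion of length `s`, the common denominator being
the leading Hankel determinant of order `s`. -/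
def recursionNum {R : Type*} [CommRing R] (s : ℕ) (g : ℕ → R) (l : Fin s) : R :=
  -((hankelMat s g).adjugate.mulVec fun i => g (i.1 + s)) l

/-- The coefficients of the recursion of length `s` satisfied by the first terms of `g`. -/
noncomputable def recursionCoeff (s : ℕ) (g : ℕ → ℂ) (l : Fin s) : ℂ :=
  recursionNum s g l / (hankelMat s g).det

theorem hankelMat_congr {R : Type*} {s : ℕ} {g g' : ℕ → R} (h : ∀ i < 2 * s, g i = g' i) :
    hankelMat s g = hankelMat s g' := by
  ext i j
  exact h _ (by omega)

theorem recursionNum_congr {R : Type*} [CommRing R] {s : ℕ} {g g' : ℕ → R}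
    (h : ∀ i < 2 * s, g i = g' i) : recursionNum s g = recursionNum s g' := by
  ext l
  have : (fun i : Fin s => g (i.1 + s)) = fun i => g' (i.1 + s) := by
    ext i; exact h _ (by omega)
  simp only [recursionNum, this, hankelMat_congr h]

theorem recursionCoeff_congr {s : ℕ} {g g' : ℕ → ℂ} (h : ∀ i < 2 * s, g i = g' i) :
    recursionCoeff s g = recursionCoeff s g' := by
  ext l
  simp only [recursionCoeff, recursionNum_congr h, hankelMat_congr h]

theorem map_hankelMat {R R' : Type*} (f : R → R') (s : ℕ) (g : ℕ → R) :
    (hankelMat s g).map f = hankelMat s (fun i => f (g i)) := rfl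

theorem map_recursionNum {R R' : Type*} [CommRing R] [CommRing R'] (f : R →+* R') (s : ℕ)
    (g : ℕ → R) (l : Fin s) : f (recursionNum s g l) = recursionNum s (fun i => f (g i)) l := by
  have h : (hankelMat s fun i => f (g i)).adjugate = (hankelMat s g).adjugate.map f := by
    rw [← map_hankelMat]
    exact (f.map_adjugate (hankelMat s g)).symm
  simp only [recursionNum, map_neg, h, Matrix.mulVec, dotProduct, map_sum, map_mul,
    Matrix.map_apply]

theorem map_det_hankelMat {R R' : Type*} [CommRing R] [CommRing R'] (f : R →+* R') (s : ℕ)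
    (g : ℕ → R) : f (hankelMat s g).det = (hankelMat s fun i => f (g i)).det := by
  rw [f.map_det]; rfl

theorem recursionDefect_recursionCoeff {s : ℕ} {g : ℕ → ℂ} (h : (hankelMat s g).det ≠ 0) {j : ℕ}
    (hj : j < s) : recursionDefect g (recursionCoeff s g) j = 0 := by
  have h1 := congrArg (fun M => M.mulVec (fun i : Fin s => g (i.1 + s)) ⟨j, hj⟩)
    (hankelMat s g).mul_adjugate
  simp only [← Matrix.mulVec_mulVec, Matrix.smul_mulVec, Matrix.one_mulVec, Pi.smul_apply,
    smul_eq_mul] at h1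
  rw [Matrix.mulVec, dotProduct] at h1
  simp only [recursionDefect, recursionCoeff, recursionNum]
  have h2 : ∑ l : Fin s, -((hankelMat s g).adjugate.mulVec fun i => g (i.1 + s)) l /
      (hankelMat s g).det * g (j + l.1) = -(∑ l : Fin s, hankelMat s g ⟨j, hj⟩ l *
      ((hankelMat s g).adjugate.mulVec fun i => g (i.1 + s)) l) / (hankelMat s g).det := by
    rw [neg_div, Finset.sum_div, ← Finset.sum_neg_distrib]
    refine Finset.sum_congr rfl fun l _ => ?_
    rw [hankelMat_apply]; ring
  rw [h2, h1]
  field_simp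
  ring

theorem eq_recursionCoeff {s : ℕ} {g : ℕ → ℂ} (h : (hankelMat s g).det ≠ 0) {c : Fin s → ℂ}
    (hc : ∀ j < s, recursionDefect g c j = 0) : c = recursionCoeff s g := by
  have h1 : (hankelMat s g).mulVec (c - recursionCoeff s g) = 0 := by
    ext j
    have h2 := hc j.1 j.2
    have h3 := recursionDefect_recursionCoeff h j.2
    simp only [recursionDefect] at h2 h3
    have h4 : ∑ l : Fin s, c l * g (j.1 + l.1) =
        ∑ l : Fin s, recursionCoeff s g l * g (j.1 + l.1) := by linear_combination h2 - h3
    simp only [Matrix.mulVec, dotProduct, hankelMat_apply, Pi.sub_apply, mul_sub,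
      Finset.sum_sub_distrib, Pi.zero_apply]
    simp only [mul_comm (g _), h4, sub_self]
  exact sub_eq_zero.1 (Matrix.eq_zero_of_mulVec_eq_zero h h1)

/-- A Hankel matrix whose sequence satisfies a recursion of length `k` has rank at most `k`. -/
theorem rank_hankelMat_le {N k : ℕ} (g : ℕ → ℂ) (c : Fin k → ℂ)
    (h : ∀ j, j + k < 2 * N - 1 → recursionDefect g c j = 0) : (hankelMat N g).rank ≤ k := by
  by_cases hkN : N ≤ k
  · exact ((hankelMat N g).rank_le_width).trans hkN
  push Not at hkN
  rw [Matrix.rank_eq_finrank_span_cols]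
  let b : Fin k → (Fin N → ℂ) := fun i => (hankelMat N g).col ⟨i.1, by omega⟩
  have hspan : Submodule.span ℂ (Set.range (hankelMat N g).col) ≤
      Submodule.span ℂ (Set.range b) := by
    rw [Submodule.span_le]
    rintro _ ⟨l, rfl⟩
    obtain ⟨l, hl⟩ := l
    induction l using Nat.strong_induction_on with
    | _ l ih =>
      by_cases hlk : l < k
      · exact Submodule.subset_span ⟨⟨l, hlk⟩, rfl⟩
      · have h1 : (hankelMat N g).col ⟨l, hl⟩ =
            -∑ i : Fin k, c i • (hankelMat N g).col ⟨l - k + i.1, by omega⟩ := by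
          ext j
          have h2 := h (j.1 + l - k) (by omega)
          simp only [recursionDefect] at h2
          have h3 : j.1 + l - k + k = j.1 + l := by omega
          have h4 : ∀ i : Fin k, j.1 + l - k + i.1 = j.1 + (l - k + i.1) := by intro i; omega
          simp only [h3, h4] at h2
          simp only [Matrix.col_apply, hankelMat_apply, Pi.neg_apply, Finset.sum_apply,
            Pi.smul_apply, smul_eq_mul]
          linear_combination h2
        rw [h1]
        exact Submodule.neg_mem _ (Submodule.sum_mem _ fun i _ =>
          Submodule.smul_mem _ _ (ih _ (by omega) _))
  have : FiniteDimensional ℂ (Submodule.span ℂ (Set.range b)) :=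
    FiniteDimensional.span_of_finite ℂ (Set.finite_range b)
  refine (Submodule.finrank_mono hspan).trans ?_
  exact (finrank_range_le_card (R := ℂ) b).trans_eq (Fintype.card_fin k)

end HankelAlgebra

/-! ### Strata and their charts. -/

section Charts

/-- A finite sequence, extended by zero. -/
def extendSeq {R : Type*} [Zero R] {n : ℕ} (u : Fin n → R) (m : ℕ) : R :=
  if h : m < n then u ⟨m, h⟩ else 0

/-- The entries of a matrix along a path which meets each antidiagonal once. -/
def antidiagonalSeq {N : ℕ} (A : Matrix (Fin N) (Fin N) ℂ) (m : ℕ) : ℂ :=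
  if h : m < 2 * N - 1 then A ⟨min m (N - 1), by omega⟩ ⟨m - min m (N - 1), by omega⟩ else 0

theorem antidiagonalSeq_hankelMat {N : ℕ} (g : ℕ → ℂ) {m : ℕ} (h : m < 2 * N - 1) :
    antidiagonalSeq (hankelMat N g) m = g m := by
  simp only [antidiagonalSeq, h, dif_pos, hankelMat_apply]
  congr 1; omega

theorem hankelMat_mem_hankelSet {N : ℕ} (g : ℕ → ℂ) : hankelMat N g ∈ hankelSet N := by
  intro j l j' l' h
  simp [h]

theorem hankelMat_antidiagonalSeq {N : ℕ} {A : Matrix (Fin N) (Fin N) ℂ} (hA : A ∈ hankelSet N) :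
    hankelMat N (antidiagonalSeq A) = A := by
  ext j l
  have h : j.1 + l.1 < 2 * N - 1 := by omega
  simp only [hankelMat_apply, antidiagonalSeq, h, dif_pos]
  exact hA _ _ _ _ (by simp only; omega)

theorem hankelMat_eq_iff {N : ℕ} {g g' : ℕ → ℂ} :
    hankelMat N g = hankelMat N g' ↔ ∀ m < 2 * N - 1, g m = g' m := by
  constructor
  · intro h m hm
    rw [← antidiagonalSeq_hankelMat g hm, h, antidiagonalSeq_hankelMat g' hm]
  · intro h
    ext j l
    exact h _ (by omega)

theorem hankel_eq_hankelMat {N : ℕ} (f : Fin (2 * N - 1) → ℂ) :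
    hankel f = hankelMat N (extendSeq f) := by
  ext j l
  have h : j.1 + l.1 < 2 * N - 1 := by omega
  simp [hankel, extendSeq, h]

/-- The position in the whole sequence of the `i`-th of the `s + k` coordinates: the first `2 * s`
terms and the last `k - s` ones are the coordinates. -/
def coordIndex (N k s i : ℕ) : ℕ := if i < 2 * s then i else i + (2 * N - 1 - s - k)

/-- The coordinates of a matrix. -/
noncomputable def coordMap (N k s : ℕ) :
    Matrix (Fin N) (Fin N) ℂ →L[ℝ] (Fin (s + k) → ℂ) :=
  LinearMap.toContinuousLinearMap
    { toFun := fun A i => antidiagonalSeq A (coordIndex N k s i)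
      map_add' := fun A B => by
        ext i
        simp only [antidiagonalSeq, Pi.add_apply]
        split_ifs <;> simp
      map_smul' := fun c A => by
        ext i
        simp only [antidiagonalSeq, Pi.smul_apply]
        split_ifs <;> simp }

@[simp] theorem coordMap_apply (N k s : ℕ) (A : Matrix (Fin N) (Fin N) ℂ) (i : Fin (s + k)) :
    coordMap N k s A i = antidiagonalSeq A (coordIndex N k s i) := rfl

/-- The sequence with given coordinates whose other terms are given by the recursion. -/
noncomputable def recursionExtension (N k s : ℕ) (u : Fin (s + k) → ℂ) (m : ℕ) : ℂ :=
  if m < 2 * s then extendSeq u m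
  -- The shift inverts `coordIndex`. From index `2 * N - 1` on the value is the default `0`, which
  -- no matrix entry uses.
  else if 2 * N - 1 - (k - s) ≤ m then extendSeq u (m - (2 * N - 1 - s - k))
  else -∑ l : Fin s, recursionCoeff s (extendSeq u) l * recursionExtension N k s u (m - s + l.1)
termination_by m
decreasing_by omega

/-- The Hankel matrix with given coordinates. -/
noncomputable def hankelChart (N k s : ℕ) (u : Fin (s + k) → ℂ) : Matrix (Fin N) (Fin N) ℂ :=
  hankelMat N (recursionExtension N k s u)

/-- The Hankel matrices whose leading section of order `s` is non-singular and for which the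
recursion of length `s` holds except at the last `k - s` indices. -/
def hankelStratum (N k s : ℕ) : Set (Matrix (Fin N) (Fin N) ℂ) :=
  {A | (hankelMat s (extendSeq (coordMap N k s A))).det ≠ 0 ∧
    hankelChart N k s (coordMap N k s A) = A}

theorem isOpen_det_ne_zero (k s : ℕ) :
    IsOpen {u : Fin (s + k) → ℂ | (hankelMat s (extendSeq u)).det ≠ 0} := by
  have h : Continuous fun u : Fin (s + k) → ℂ => (hankelMat s (extendSeq u)).det := by
    refine Continuous.matrix_det (continuous_matrix fun i j => ?_)
    simp only [hankelMat_apply, extendSeq]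
    split_ifs <;> fun_prop
  exact isOpen_ne_fun h continuous_const

theorem extendSeq_coordMap {N k s : ℕ} (hsk : s ≤ k) (A : Matrix (Fin N) (Fin N) ℂ)
    {m : ℕ} (hm : m < 2 * s) : extendSeq (coordMap N k s A) m = antidiagonalSeq A m := by
  have h : m < s + k := by omega
  simp [extendSeq, h, coordIndex, hm]

theorem coordMap_hankelChart {N k s : ℕ} (hsk : s ≤ k) (hkN : k < N) (u : Fin (s + k) → ℂ) :
    coordMap N k s (hankelChart N k s u) = u := by
  ext i
  have hi := i.2
  rw [coordMap_apply, hankelChart, antidiagonalSeq_hankelMat _ (by unfold coordIndex; split_ifs <;> omega),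
    recursionExtension]
  by_cases h : i.1 < 2 * s
  · simp [coordIndex, h, extendSeq]
  · have h1 : ¬ (i.1 + (2 * N - 1 - s - k) < 2 * s) := by omega
    have h2 : 2 * N - 1 - (k - s) ≤ i.1 + (2 * N - 1 - s - k) := by omega
    simp [coordIndex, h, extendSeq, h1, h2]

theorem coordMap_surjective {N k s : ℕ} (hsk : s ≤ k) (hkN : k < N) :
    Function.Surjective (coordMap N k s) := fun u => ⟨_, coordMap_hankelChart hsk hkN u⟩

theorem hankelMat_mem_stratum {N k s : ℕ} (hsk : s ≤ k) (hkN : k < N) {g : ℕ → ℂ}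
    (hdet : (hankelMat s g).det ≠ 0)
    (hrec : ∀ j, j + k < 2 * N - 1 → recursionDefect g (recursionCoeff s g) j = 0) :
    hankelMat N g ∈ hankelStratum N k s := by
  have h0 : ∀ m < 2 * s, extendSeq (coordMap N k s (hankelMat N g)) m = g m := fun m hm => by
    rw [extendSeq_coordMap hsk _ hm, antidiagonalSeq_hankelMat _ (by omega)]
  refine ⟨by rwa [hankelMat_congr h0], ?_⟩
  rw [hankelChart, hankelMat_eq_iff]
  intro m
  induction m using Nat.strong_induction_on with
  | _ m ih =>
    intro hm
    rw [recursionExtension]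
    split_ifs with h1 h2
    · exact h0 m h1
    · have h3 : m - (2 * N - 1 - s - k) < s + k := by omega
      have h4 : ¬ m - (2 * N - 1 - s - k) < 2 * s := by omega
      simp only [extendSeq, h3, dif_pos, coordMap_apply, coordIndex, h4, if_false]
      rw [antidiagonalSeq_hankelMat _ (by omega)]
      congr 1; omega
    · have h3 := hrec (m - s) (by omega)
      simp only [recursionDefect] at h3
      have h4 : m - s + s = m := by omega
      rw [h4] at h3
      rw [Finset.sum_congr rfl fun l _ => by rw [ih (m - s + l.1) (by omega) (by omega),
        recursionCoeff_congr h0]]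
      linear_combination -h3

theorem recursionDefect_recursionExtension {N k : ℕ} {u : Fin (k + k) → ℂ}
    (hdet : (hankelMat k (extendSeq u)).det ≠ 0) (j : ℕ) (hj : j + k < 2 * N - 1) :
    recursionDefect (recursionExtension N k k u) (recursionCoeff k (extendSeq u)) j = 0 := by
  have h0 : ∀ m < 2 * k, recursionExtension N k k u m = extendSeq u m := fun m hm => by
    rw [recursionExtension, if_pos hm]
  by_cases hjk : j < k
  · have h1 := recursionDefect_recursionCoeff hdet hjk
    rw [recursionDefect] at h1 ⊢
    rw [h0 _ (by omega), Finset.sum_congr rfl fun l _ => by rw [h0 (j + l.1) (by omega)]]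
    exact h1
  · rw [recursionDefect, recursionExtension, if_neg (by omega), if_neg (by omega)]
    have : j + k - k = j := by omega
    rw [this]; ring

theorem hankelChart_mem {N k : ℕ} {u : Fin (k + k) → ℂ}
    (hdet : (hankelMat k (extendSeq u)).det ≠ 0) :
    hankelChart N k k u ∈ rankSet N k ∩ hankelSet N :=
  ⟨rank_hankelMat_le _ _ (recursionDefect_recursionExtension hdet), hankelMat_mem_hankelSet _⟩

/-- Every Hankel matrix of rank at most `k` lies in one of the strata. -/
theorem exists_mem_stratum {N k : ℕ} (hkN : k < N) {A : Matrix (Fin N) (Fin N) ℂ}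
    (hA : A ∈ rankSet N k ∩ hankelSet N) :
    ∃ s ≤ k, A ∈ hankelStratum N k s := by
  classical
  set g := antidiagonalSeq A
  have hAg : hankelMat N g = A := hankelMat_antidiagonalSeq hA.2
  -- Order `0` always qualifies, the empty determinant being `1`.
  let s := Nat.findGreatest (fun s => (hankelMat s g).det ≠ 0) k
  have hs : (hankelMat s g).det ≠ 0 :=
    Nat.findGreatest_spec (P := fun s => (hankelMat s g).det ≠ 0) (Nat.zero_le k) (by simp)
  have hsk : s ≤ k := Nat.findGreatest_le k
  refine ⟨s, hsk, hAg ▸ hankelMat_mem_stratum hsk hkN hs fun j hj => ?_⟩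
  refine recursionDefect_eq_zero hsk g _ hs (fun n hn hnk => ?_) (by rw [hAg]; exact hA.1)
    (fun j hj => recursionDefect_recursionCoeff hs hj) j hj
  by_contra h
  exact Nat.findGreatest_is_greatest hn hnk h

theorem mem_stratum_of_det_ne_zero {N k : ℕ} (hkN : k < N) {A : Matrix (Fin N) (Fin N) ℂ}
    (hA : A ∈ rankSet N k ∩ hankelSet N) (hdet : (hankelMat k (antidiagonalSeq A)).det ≠ 0) :
    A ∈ hankelStratum N k k := by
  have hAg : hankelMat N (antidiagonalSeq A) = A := hankelMat_antidiagonalSeq hA.2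
  rw [← hAg]
  refine hankelMat_mem_stratum le_rfl hkN hdet fun j hj => ?_
  exact recursionDefect_eq_zero le_rfl _ _ hdet (fun n hn hnk => by omega)
    (by rw [hAg]; exact hA.1) (fun j hj => recursionDefect_recursionCoeff hdet hj) j hj

theorem contDiff_det {E : Type*} [NormedAddCommGroup E] [NormedSpace ℝ E] {n : ℕ}
    {M : E → Matrix (Fin n) (Fin n) ℂ} (hM : ∀ i j, ContDiff ℝ ∞ fun x => M x i j) :
    ContDiff ℝ ∞ fun x => (M x).det := by
  simp only [Matrix.det_apply]
  exact ContDiff.sum fun σ _ => ContDiff.const_smul _ (contDiff_prod fun i _ => hM _ _)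

theorem contDiff_adjugate {E : Type*} [NormedAddCommGroup E] [NormedSpace ℝ E] {n : ℕ}
    {M : E → Matrix (Fin n) (Fin n) ℂ} (hM : ∀ i j, ContDiff ℝ ∞ fun x => M x i j) (i j : Fin n) :
    ContDiff ℝ ∞ fun x => (M x).adjugate i j := by
  simp only [Matrix.adjugate_apply]
  refine contDiff_det fun i' j' => ?_
  simp only [Matrix.updateRow_apply]
  split_ifs
  · exact contDiff_const
  · exact hM _ _

theorem contDiff_extendSeq {n : ℕ} (m : ℕ) :
    ContDiff ℝ ∞ fun u : Fin n → ℂ => extendSeq u m := by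
  simp only [extendSeq]
  split_ifs
  · exact contDiff_apply ℝ ℂ _
  · exact contDiff_const

theorem contDiffOn_recursionCoeff {k s : ℕ} (l : Fin s) :
    ContDiffOn ℝ ∞ (fun u : Fin (s + k) → ℂ => recursionCoeff s (extendSeq u) l)
      {u | (hankelMat s (extendSeq u)).det ≠ 0} := by
  simp only [recursionCoeff, recursionNum, Matrix.mulVec, dotProduct, div_eq_mul_inv]
  refine ContDiffOn.mul (ContDiff.contDiffOn ?_) (ContDiffOn.inv (ContDiff.contDiffOn ?_) fun u hu => hu)
  · exact (ContDiff.sum fun i _ => (contDiff_adjugate (fun i j => contDiff_extendSeq _) _ _).mul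
      (contDiff_extendSeq _)).neg
  · exact contDiff_det fun i j => contDiff_extendSeq _

theorem contDiffOn_recursionExtension {N k s : ℕ} (m : ℕ) :
    ContDiffOn ℝ ∞ (fun u : Fin (s + k) → ℂ => recursionExtension N k s u m)
      {u | (hankelMat s (extendSeq u)).det ≠ 0} := by
  induction m using Nat.strong_induction_on with
  | _ m ih =>
    simp_rw [recursionExtension.eq_def N k s _ m]
    split_ifs with h1 h2
    · exact (contDiff_extendSeq _).contDiffOn
    · exact (contDiff_extendSeq _).contDiffOn
    · exact (ContDiffOn.sum fun l _ => (contDiffOn_recursionCoeff l).mul (ih _ (by omega))).neg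

theorem contDiffOn_matrix {E : Type*} [NormedAddCommGroup E] [NormedSpace ℝ E] {N : ℕ}
    {M : E → Matrix (Fin N) (Fin N) ℂ} {O : Set E} {n : WithTop ℕ∞}
    (hM : ∀ i j, ContDiffOn ℝ n (fun x => M x i j) O) : ContDiffOn ℝ n M O := by
  let T : (Fin N → Fin N → ℂ) →L[ℝ] Matrix (Fin N) (Fin N) ℂ :=
    LinearMap.toContinuousLinearMap (Matrix.ofLinearEquiv ℝ).toLinearMap
  have h : ContDiffOn ℝ n (fun x => fun i j => M x i j) O :=
    contDiffOn_pi.2 fun i => contDiffOn_pi.2 fun j => hM i j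
  exact T.contDiff.comp_contDiffOn h

theorem contDiffOn_hankelChart {N k s : ℕ} :
    ContDiffOn ℝ ∞ (hankelChart N k s) {u | (hankelMat s (extendSeq u)).det ≠ 0} :=
  contDiffOn_matrix fun _ _ => contDiffOn_recursionExtension _

theorem isSubmanifold_hankelChart {N k s d : ℕ} (hsk : s ≤ k) (hkN : k < N)
    {H : Type*} [NormedAddCommGroup H] [NormedSpace ℝ H] [FiniteDimensional ℝ H]
    {O : Set (Fin (s + k) → ℂ)} (hO : IsOpen O)
    (hdet : O ⊆ {u | (hankelMat s (extendSeq u)).det ≠ 0})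
    {h : (Fin (s + k) → ℂ) → H} (hh : ContDiffOn ℝ ∞ h O)
    (hsub : ∀ u ∈ O, h u = 0 → Function.Surjective (fderiv ℝ h u))
    (hd : d + Module.finrank ℝ H = 2 * (s + k)) :
    IsSubmanifold d {A : Matrix (Fin N) (Fin N) ℂ | coordMap N k s A ∈ O ∧
      hankelChart N k s (coordMap N k s A) = A ∧ h (coordMap N k s A) = 0} := by
  refine isSubmanifold_graph _ (coordMap_surjective hsk hkN) _ h hO
    (contDiffOn_hankelChart.mono hdet) hh (fun u _ => coordMap_hankelChart hsk hkN u) hsub ?_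
  rw [hd, Module.finrank_pi_fintype]
  simp [Complex.finrank_real_complex, mul_comm]

theorem isSubmanifold_hankelChart_open {N k s : ℕ} (hsk : s ≤ k) (hkN : k < N)
    {O : Set (Fin (s + k) → ℂ)} (hO : IsOpen O)
    (hdet : O ⊆ {u | (hankelMat s (extendSeq u)).det ≠ 0}) :
    IsSubmanifold (2 * (s + k)) {A : Matrix (Fin N) (Fin N) ℂ | coordMap N k s A ∈ O ∧
      hankelChart N k s (coordMap N k s A) = A} := by
  -- No further equation is imposed: its target has dimension zero.
  have := isSubmanifold_hankelChart (N := N) (d := 2 * (s + k)) (H := Fin 0 → ℝ) hsk hkN hO hdet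
    (h := fun _ => 0) contDiffOn_const (fun u _ _ y => ⟨0, Subsingleton.elim _ _⟩) (by simp)
  simpa using this

end Charts

/-! ### The generic class, and thinness of its complement. -/

section Generic

/-- The monic polynomial with the given lower coefficients. -/
noncomputable def monicPoly {k : ℕ} (c : Fin k → ℂ) : ℂ[X] :=
  X ^ k + ∑ l : Fin k, C (c l) * X ^ l.1

theorem degree_sum_lt {k : ℕ} (c : Fin k → ℂ) :
    (∑ l : Fin k, C (c l) * X ^ l.1).degree < (k : WithBot ℕ) := by
  refine (degree_sum_le _ _).trans_lt ((Finset.sup_lt_iff (WithBot.bot_lt_coe k)).2 fun l _ => ?_)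
  exact (degree_C_mul_X_pow_le _ _).trans_lt (WithBot.coe_lt_coe.2 l.2)

theorem monic_monicPoly {k : ℕ} (c : Fin k → ℂ) : (monicPoly c).Monic :=
  monic_X_pow_add (degree_sum_lt c)

theorem natDegree_monicPoly {k : ℕ} (c : Fin k → ℂ) : (monicPoly c).natDegree = k := by
  rw [natDegree_eq_of_degree_eq_some]
  rw [monicPoly, degree_add_eq_left_of_degree_lt (by rw [degree_X_pow]; exact degree_sum_lt c),
    degree_X_pow]

theorem coeff_monicPoly {k : ℕ} (c : Fin k → ℂ) (l : Fin k) : (monicPoly c).coeff l.1 = c l := by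
  simp only [monicPoly, coeff_add, coeff_X_pow, finsetSum_coeff, coeff_C_mul]
  rw [if_neg l.2.ne, Finset.sum_eq_single l]
  · simp
  · intro i _ hi
    rw [if_neg (fun h => hi (Fin.ext h.symm)), mul_zero]
  · simp

theorem eq_monicPoly {k : ℕ} {P : ℂ[X]} (hP : P.Monic) (hd : P.natDegree = k) :
    P = monicPoly fun l : Fin k => P.coeff l.1 := by
  ext i
  rcases lt_trichotomy i k with h | rfl | h
  · exact (coeff_monicPoly (fun l : Fin k => P.coeff l.1) ⟨i, h⟩).symm
  · have h1 := (monic_monicPoly fun l : Fin i => P.coeff l.1).coeff_natDegree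
    have h2 := hP.coeff_natDegree
    rw [natDegree_monicPoly] at h1
    rw [hd] at h2
    rw [h1, h2]
  · rw [coeff_eq_zero_of_natDegree_lt (hd ▸ h),
      coeff_eq_zero_of_natDegree_lt ((natDegree_monicPoly _).symm ▸ h)]

theorem isCentralPolynomial_iff {N k : ℕ} (f : Fin (2 * N - 1) → ℂ) (P : ℂ[X]) :
    IsCentralPolynomial k f P ↔ P.Monic ∧ P.natDegree = k ∧ ∀ j, j + k < 2 * N - 1 →
      recursionDefect (extendSeq f) (fun l : Fin k => P.coeff l.1) j = 0 := by
  refine and_congr_right fun h1 => and_congr_right fun h2 => forall_congr' fun j =>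
    forall_congr' fun hj => ?_
  have h3 : P.coeff k = 1 := h2 ▸ h1.coeff_natDegree
  have h4 : ∀ l : Fin (k + 1), f ⟨j + l.1, by omega⟩ = extendSeq f (j + l.1) := fun l => by
    have : j + l.1 < 2 * N - 1 := by omega
    simp [extendSeq, this]
  simp only [h4]
  rw [Fin.sum_univ_castSucc, recursionDefect]
  simp [h3, add_comm]

/-- The denominator-free version of the polynomial attached to the recursion of length `k`. -/
noncomputable def scaledPoly {R : Type*} [CommRing R] (k : ℕ) (g : ℕ → R) : R[X] :=
  C (hankelMat k g).det * X ^ k + ∑ l : Fin k, C (recursionNum k g l) * X ^ l.1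

theorem map_scaledPoly {R R' : Type*} [CommRing R] [CommRing R'] (φ : R →+* R') (k : ℕ)
    (g : ℕ → R) : (scaledPoly k g).map φ = scaledPoly k fun i => φ (g i) := by
  simp only [scaledPoly, Polynomial.map_add, Polynomial.map_mul, Polynomial.map_pow, map_X, map_C,
    Polynomial.map_sum]
  simp only [map_det_hankelMat φ, map_recursionNum φ]

theorem scaledPoly_eq {k : ℕ} {g : ℕ → ℂ} (h : (hankelMat k g).det ≠ 0) :
    scaledPoly k g = C (hankelMat k g).det * monicPoly (recursionCoeff k g) := by
  have h1 : ∀ l : Fin k, C (recursionNum k g l) =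
      C (hankelMat k g).det * C (recursionCoeff k g l) := fun l => by
    rw [← C_mul, recursionCoeff, mul_div_cancel₀ _ h]
  simp only [scaledPoly, monicPoly, mul_add, Finset.mul_sum, h1, mul_assoc]

/-- A polynomial in the coordinates which vanishes when the polynomial of the recursion has a
multiple root or vanishes at the origin. -/
noncomputable def genericityPoly (k : ℕ) : MvPolynomial (Fin (k + k)) ℂ :=
  (scaledPoly k (extendSeq MvPolynomial.X)).coeff 0 *
    resultant (scaledPoly k (extendSeq MvPolynomial.X))
      (derivative (scaledPoly k (extendSeq MvPolynomial.X))) k (k - 1)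

theorem eval_genericityPoly {k : ℕ} (u : Fin (k + k) → ℂ) :
    MvPolynomial.eval u (genericityPoly k) = (scaledPoly k (extendSeq u)).coeff 0 *
      resultant (scaledPoly k (extendSeq u)) (derivative (scaledPoly k (extendSeq u))) k (k - 1) := by
  have h1 : (scaledPoly k (extendSeq MvPolynomial.X)).map (MvPolynomial.eval u) =
      scaledPoly k (extendSeq u) := by
    rw [map_scaledPoly]
    congr 1
    ext m
    simp only [extendSeq]
    split_ifs <;> simp
  rw [genericityPoly, map_mul, ← coeff_map, ← resultant_map_map, ← derivative_map, h1]

/-- Clearing denominators only multiplies the constant term and the resultant by powers of the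
non-zero leading determinant; over `ℂ`, a non-zero resultant with the derivative means simple roots.
-/
theorem eval_genericityPoly_ne_zero_iff {k : ℕ} {u : Fin (k + k) → ℂ}
    (h : (hankelMat k (extendSeq u)).det ≠ 0) :
    MvPolynomial.eval u (genericityPoly k) ≠ 0 ↔
      ¬ (monicPoly (recursionCoeff k (extendSeq u))).IsRoot 0 ∧
        (monicPoly (recursionCoeff k (extendSeq u))).roots.Nodup := by
  set P := monicPoly (recursionCoeff k (extendSeq u))
  have hP : P.Monic := monic_monicPoly _
  have hd : P.natDegree = k := natDegree_monicPoly _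
  have hd' : P.derivative.natDegree = k - 1 := by rw [natDegree_derivative, hd]
  rw [eval_genericityPoly, scaledPoly_eq h, derivative_C_mul, resultant_C_mul_left,
    resultant_C_mul_right, coeff_C_mul, mul_ne_zero_iff, mul_ne_zero_iff, mul_ne_zero_iff,
    mul_ne_zero_iff]
  have h1 : resultant P (derivative P) k (k - 1) = resultant P (derivative P) := by
    rw [hd, hd']
  have h2 : resultant P (derivative P) ≠ 0 ↔ P.roots.Nodup := by
    rw [nodup_roots_iff_of_splits hP.ne_zero (IsAlgClosed.splits P), Ne, resultant_eq_zero_iff,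
      Polynomial.Separable]
    simp [hP.ne_zero]
  have h3 : ¬ P.IsRoot 0 ↔ P.coeff 0 ≠ 0 := by rw [IsRoot, ← coeff_zero_eq_eval_zero]
  rw [h1, h2, h3]
  exact ⟨fun H => ⟨H.1.2, H.2.2.2⟩, fun H => ⟨⟨h, H.1⟩, pow_ne_zero _ h, pow_ne_zero _ h, H.2⟩⟩

theorem genericityPoly_ne_zero {k : ℕ} (hk : 1 ≤ k) : genericityPoly k ≠ 0 := by
  -- The witness has recursion `g (j + k) = g j`, hence polynomial `X ^ k - 1`; its leading Hankel
  -- section is the exchange matrix.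
  let g : ℕ → ℂ := fun m => if m = k - 1 ∨ m = 2 * k - 1 then 1 else 0
  let u : Fin (k + k) → ℂ := fun i => g i.1
  have hug : ∀ m < 2 * k, extendSeq u m = g m := fun m hm => by
    have : m < k + k := by omega
    simp [extendSeq, this, u]
  have hdet : (hankelMat k g).det ≠ 0 := by
    intro h0
    obtain ⟨v, hv0, hv⟩ := Matrix.exists_mulVec_eq_zero_iff.2 h0
    apply hv0
    ext i
    have h1 := congrFun hv ⟨k - 1 - i.1, by omega⟩
    simp only [Matrix.mulVec, dotProduct, hankelMat_apply] at h1
    rw [Finset.sum_eq_single i] at h1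
    · have : k - 1 - i.1 + i.1 = k - 1 := by omega
      simpa [g, this] using h1
    · intro l _ hl
      have h2 : l.1 ≠ i.1 := fun h => hl (Fin.ext h)
      have h3 : ¬ (k - 1 - i.1 + l.1 = k - 1 ∨ k - 1 - i.1 + l.1 = 2 * k - 1) := by omega
      simp [g, h3]
    · simp
  let c : Fin k → ℂ := fun l => if l.1 = 0 then -1 else 0
  have hc : c = recursionCoeff k g := by
    refine eq_recursionCoeff hdet fun j hj => ?_
    rw [recursionDefect, Finset.sum_eq_single ⟨0, hk⟩]
    · have h1 : (j + k = k - 1 ∨ j + k = 2 * k - 1) ↔ (j = k - 1 ∨ j = 2 * k - 1) := by omega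
      simp only [c, g, h1, add_zero]
      split_ifs <;> simp
    · intro l _ hl
      have : l.1 ≠ 0 := fun h => hl (Fin.ext h)
      simp [c, this]
    · simp
  have hmon : monicPoly c = X ^ k - 1 := by
    rw [monicPoly, Finset.sum_eq_single ⟨0, hk⟩]
    · simp [c, sub_eq_add_neg]
    · intro l _ hl
      have : l.1 ≠ 0 := fun h => hl (Fin.ext h)
      simp [c, this]
    · simp
  have hdet' : (hankelMat k (extendSeq u)).det ≠ 0 := by rwa [hankelMat_congr hug]
  have h := (eval_genericityPoly_ne_zero_iff hdet').2 (by
    rw [recursionCoeff_congr hug, ← hc, hmon]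
    refine ⟨by simp [IsRoot, show k ≠ 0 by omega], ?_⟩
    refine nodup_roots (X_pow_sub_one_separable_iff.2 ?_)
    exact_mod_cast (show k ≠ 0 by omega))
  intro h0
  simp [h0] at h

theorem isOpen_generic (k : ℕ) : IsOpen {u : Fin (k + k) → ℂ |
    (hankelMat k (extendSeq u)).det ≠ 0 ∧ MvPolynomial.eval u (genericityPoly k) ≠ 0} :=
  (isOpen_det_ne_zero k k).inter
    (isOpen_ne_fun (MvPolynomial.contDiff_eval _).continuous continuous_const)

theorem submatrix_eq_hankelMat {N k : ℕ} (hkN : k < N) {A : Matrix (Fin N) (Fin N) ℂ}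
    (hA : A ∈ hankelSet N) : A.submatrix (Fin.castLE hkN.le) (Fin.castLE hkN.le) =
      hankelMat k (antidiagonalSeq A) := by
  conv_lhs => rw [← hankelMat_antidiagonalSeq hA]
  rfl

/-- Exhibits the generic class as the part of the top stratum over an open set of coordinates, hence
as a manifold of dimension `4 * k`. -/
theorem genericHankelSet_eq {N k : ℕ} (hkN : k < N) :
    genericHankelSet hkN = {A | coordMap N k k A ∈ {u : Fin (k + k) → ℂ |
      (hankelMat k (extendSeq u)).det ≠ 0 ∧ MvPolynomial.eval u (genericityPoly k) ≠ 0} ∧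
      hankelChart N k k (coordMap N k k A) = A} := by
  ext A
  have hext : ∀ m < 2 * k, extendSeq (coordMap N k k A) m = antidiagonalSeq A m :=
    fun m hm => extendSeq_coordMap le_rfl A hm
  constructor
  · rintro ⟨hA, hdet, f, P, rfl, hP, hP0, hPn⟩
    rw [submatrix_eq_hankelMat hkN hA.2] at hdet
    have hmem := mem_stratum_of_det_ne_zero hkN hA hdet
    refine ⟨⟨hmem.1, (eval_genericityPoly_ne_zero_iff hmem.1).2 ?_⟩, hmem.2⟩
    obtain ⟨h1, h2, h3⟩ := (isCentralPolynomial_iff f P).1 hP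
    have h4 : ∀ m < 2 * k, antidiagonalSeq (hankel f) m = extendSeq f m := fun m hm => by
      rw [hankel_eq_hankelMat, antidiagonalSeq_hankelMat _ (by omega)]
    have h5 := eq_recursionCoeff (g := extendSeq f) (by rwa [← hankelMat_congr h4])
      fun j hj => h3 j (by omega)
    rw [recursionCoeff_congr hext, recursionCoeff_congr h4, ← h5, ← eq_monicPoly h1 h2]
    exact ⟨hP0, hPn⟩
  · rintro ⟨⟨hdet, hQ⟩, hch⟩
    set u := coordMap N k k A
    have hA : A ∈ rankSet N k ∩ hankelSet N := hch ▸ hankelChart_mem hdet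
    obtain ⟨h0, h1⟩ := (eval_genericityPoly_ne_zero_iff hdet).1 hQ
    refine ⟨hA, ?_, fun i => recursionExtension N k k u i.1,
      monicPoly (recursionCoeff k (extendSeq u)), ?_, ?_, h0, h1⟩
    · rw [submatrix_eq_hankelMat hkN hA.2, ← hankelMat_congr hext]
      exact hdet
    · rw [← hch, hankelChart, hankel_eq_hankelMat, hankelMat_eq_iff]
      intro m hm
      simp [extendSeq, hm, u]
    · refine (isCentralPolynomial_iff _ _).2 ⟨monic_monicPoly _, natDegree_monicPoly _,
        fun j hj => ?_⟩
      have h2 := recursionDefect_recursionExtension hdet j hj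
      simp only [coeff_monicPoly]
      rw [← h2]
      have h3 : ∀ m < 2 * N - 1, extendSeq (fun i : Fin (2 * N - 1) =>
          recursionExtension N k k u i.1) m = recursionExtension N k k u m := fun m hm => by
        simp [extendSeq, hm]
      simp only [recursionDefect]
      rw [h3 _ hj, Finset.sum_congr rfl fun l _ => by rw [h3 (j + l.1) (by omega)]]

theorem isThinRelativeTo_of_fintype {V ι : Type*} [NormedAddCommGroup V] [NormedSpace ℝ V]
    [FiniteDimensional ℝ V] [Fintype ι] {E M : Set V} {D : ℕ} (hM : IsSubmanifold D M)
    (S : ι → Set V) (hS : ∀ i, ∃ d < D, IsSubmanifold d (S i)) (hE : E ⊆ ⋃ i, S i) :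
    IsThinRelativeTo E M := by
  refine ⟨D, hM, Fintype.card ι, fun j => S ((Fintype.equivFin ι).symm j), fun j => hS _, ?_⟩
  rwa [(Fintype.equivFin ι).symm.surjective.iUnion_comp S]

theorem isThinRelativeTo_nongeneric {N k : ℕ} (hk : 1 ≤ k) (hkN : k < N) :
    IsThinRelativeTo ((rankSet N k ∩ hankelSet N) \ genericHankelSet hkN)
      (genericHankelSet hkN) := by
  have hgen := genericHankelSet_eq (k := k) hkN
  obtain ⟨t, ht⟩ := MvPolynomial.exists_finset_regular_zeros _ (genericityPoly_ne_zero hk)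
  refine isThinRelativeTo_of_fintype (ι := Fin k ⊕ t) (D := 2 * (k + k)) ?_
    (Sum.elim (fun s => hankelStratum N k s.1) fun q => {A | coordMap N k k A ∈
      {u : Fin (k + k) → ℂ | (hankelMat k (extendSeq u)).det ≠ 0 ∧
        MvPolynomial.eval u (MvPolynomial.pderiv q.1.2 q.1.1) ≠ 0} ∧
      hankelChart N k k (coordMap N k k A) = A ∧
      MvPolynomial.eval (coordMap N k k A) q.1.1 = 0}) ?_ ?_
  · rw [hgen]
    exact isSubmanifold_hankelChart_open le_rfl hkN (isOpen_generic k) fun u hu => hu.1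
  · rintro (s | q)
    · refine ⟨2 * (s.1 + k), by omega, ?_⟩
      exact isSubmanifold_hankelChart_open s.2.le hkN (isOpen_det_ne_zero k s.1) fun u hu => hu
    · refine ⟨2 * (k + k) - 2, by omega, ?_⟩
      refine isSubmanifold_hankelChart le_rfl hkN (H := ℂ) ?_ (fun u hu => hu.1)
        (h := fun u => MvPolynomial.eval u q.1.1)
        (MvPolynomial.contDiff_eval _).contDiffOn
        (fun u hu _ => MvPolynomial.surjective_fderiv_eval hu.2) ?_
      · exact (isOpen_det_ne_zero k k).inter
          (isOpen_ne_fun (MvPolynomial.contDiff_eval _).continuous continuous_const)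
      · rw [Complex.finrank_real_complex]; omega
  · rintro A ⟨hA, hAn⟩
    obtain ⟨s, hs, hmem⟩ := exists_mem_stratum hkN hA
    rcases hs.lt_or_eq with hlt | rfl
    · exact Set.mem_iUnion.2 ⟨Sum.inl ⟨s, hlt⟩, hmem⟩
    · have hQ : MvPolynomial.eval (coordMap N s s A) (genericityPoly s) = 0 := by
        by_contra h
        exact hAn (hgen ▸ ⟨⟨hmem.1, h⟩, hmem.2⟩)
      obtain ⟨q, hq, hq0, hq1⟩ := ht _ hQ
      exact Set.mem_iUnion.2 ⟨Sum.inr ⟨q, hq⟩, ⟨hmem.1, hq1⟩, hmem.2, hq0⟩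

end Generic

/-! ### The rank set and its tangent Hankel directions. -/

section Rank

theorem isClosed_rankSet (N k : ℕ) : IsClosed (rankSet N k) := by
  let T : Matrix (Fin N) (Fin N) ℂ →ₗ[ℂ] ((Fin N → ℂ) →L[ℂ] (Fin N → ℂ)) :=
    LinearMap.toContinuousLinearMap.toLinearMap ∘ₗ Matrix.toLin'.toLinearMap
  have hT : Continuous T := T.continuous_of_finiteDimensional
  have h1 := (isOpen_setOfPred_nat_le_rank (𝕜 := ℂ) (E := Fin N → ℂ) (F := Fin N → ℂ) (k + 1)).preimage hT
  rw [← isOpen_compl_iff]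
  convert h1 using 1
  ext A
  simp only [rankSet, Set.mem_compl_iff, Set.mem_ofPred_eq, not_le, Set.mem_preimage]
  have h2 : (((T A : (Fin N → ℂ) →L[ℂ] (Fin N → ℂ)) : (Fin N → ℂ) →ₗ[ℂ] (Fin N → ℂ))).rank =
      (A.rank : Cardinal) := by
    rw [LinearMap.rank, ← Module.finrank_eq_rank]
    rfl
  rw [h2]
  exact_mod_cast Nat.lt_iff_add_one_le

/-- The skeleton decomposition `C P⁻¹ R` of a matrix, built from its first `k` columns `C`, its
first `k` rows `R` and its leading submatrix `P` of order `k`. -/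
noncomputable def skeleton {N k : ℕ} (h : k ≤ N) (M : Matrix (Fin N) (Fin N) ℂ) :
    Matrix (Fin N) (Fin N) ℂ :=
  M.submatrix id (Fin.castLE h) * (M.submatrix (Fin.castLE h) (Fin.castLE h))⁻¹ *
    M.submatrix (Fin.castLE h) id

theorem skeleton_mem_rankSet {N k : ℕ} (h : k ≤ N) (M : Matrix (Fin N) (Fin N) ℂ) :
    skeleton h M ∈ rankSet N k :=
  (Matrix.rank_mul_le_right _ _).trans (Matrix.rank_le_height _)

/-- The first `k` columns are independent, so by the rank bound they span all columns. The
coefficients of each column are read off from its first `k` entries by inverting the leading block.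
-/
theorem skeleton_eq_self {N k : ℕ} (h : k ≤ N) {M : Matrix (Fin N) (Fin N) ℂ}
    (hM : M ∈ rankSet N k) (hdet : (M.submatrix (Fin.castLE h) (Fin.castLE h)).det ≠ 0) :
    skeleton h M = M := by
  set P := M.submatrix (Fin.castLE h) (Fin.castLE h) with hP
  set C := M.submatrix id (Fin.castLE h) with hC
  have hCP : ∀ x i, (C.mulVec x) (Fin.castLE h i) = (P.mulVec x) i := fun x i => rfl
  have hinj : Function.Injective C.mulVecLin := by
    rw [injective_iff_map_eq_zero]
    intro x hx
    refine Matrix.eq_zero_of_mulVec_eq_zero hdet ?_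
    ext i
    rw [← hCP]
    exact congrFun hx _
  have hle : C.mulVecLin.range ≤ M.mulVecLin.range := by
    rw [Matrix.range_mulVecLin, Matrix.range_mulVecLin]
    refine Submodule.span_mono ?_
    rintro _ ⟨i, rfl⟩
    exact ⟨Fin.castLE h i, rfl⟩
  have heq : C.mulVecLin.range = M.mulVecLin.range := by
    refine Submodule.eq_of_le_of_finrank_le hle ?_
    rw [LinearMap.finrank_range_of_inj hinj, Module.finrank_fin_fun]
    exact hM
  ext j l
  obtain ⟨x, hx⟩ : M.col l ∈ C.mulVecLin.range := by
    rw [heq, Matrix.range_mulVecLin]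
    exact Submodule.subset_span ⟨l, rfl⟩
  have hx' : C.mulVec x = M.col l := hx
  have hPx : P.mulVec x = fun i => M (Fin.castLE h i) l := by
    ext i
    rw [← hCP, hx']; rfl
  have hu : IsUnit P.det := isUnit_iff_ne_zero.2 hdet
  have hsol : P⁻¹.mulVec (fun i => M (Fin.castLE h i) l) = x := by
    rw [← hPx, Matrix.mulVec_mulVec, Matrix.nonsing_inv_mul _ hu, Matrix.one_mulVec]
  have : skeleton h M j l = (C.mulVec (P⁻¹.mulVec fun i => M (Fin.castLE h i) l)) j := by
    rw [Matrix.mulVec_mulVec]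
    rfl
  rw [this, hsol, hx']
  rfl

/-- The entry of a matrix as a continuous linear map. -/
noncomputable def entryCLM {N : ℕ} (j l : Fin N) : Matrix (Fin N) (Fin N) ℂ →L[ℝ] ℂ :=
  LinearMap.toContinuousLinearMap (Matrix.entryLinearMap ℝ ℂ j l)

@[simp] theorem entryCLM_apply {N : ℕ} (j l : Fin N) (A : Matrix (Fin N) (Fin N) ℂ) :
    entryCLM j l A = A j l := rfl

theorem contDiff_entry {N : ℕ} (j l : Fin N) :
    ContDiff ℝ ∞ fun A : Matrix (Fin N) (Fin N) ℂ => A j l := (entryCLM j l).contDiff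

theorem isOpen_leading_det_ne_zero {N k : ℕ} (h : k ≤ N) :
    IsOpen {M : Matrix (Fin N) (Fin N) ℂ |
      (M.submatrix (Fin.castLE h) (Fin.castLE h)).det ≠ 0} :=
  isOpen_ne_fun (contDiff_det fun _ _ => contDiff_entry _ _).continuous continuous_const

theorem contDiffOn_skeleton {N k : ℕ} (h : k ≤ N) : ContDiffOn ℝ ∞ (skeleton h)
    {M | (M.submatrix (Fin.castLE h) (Fin.castLE h)).det ≠ 0} := by
  refine contDiffOn_matrix fun j l => ?_
  simp only [skeleton, Matrix.mul_apply, Matrix.inv_def, Ring.inverse_eq_inv', Matrix.smul_apply,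
    smul_eq_mul, Matrix.submatrix_apply, id]
  refine ContDiffOn.sum fun i _ => ContDiffOn.mul (ContDiffOn.sum fun i' _ => ?_)
    (contDiff_entry _ _).contDiffOn
  refine (contDiff_entry _ _).contDiffOn.mul (ContDiffOn.mul (ContDiffOn.inv
    (contDiff_det fun _ _ => contDiff_entry _ _).contDiffOn fun u hu => hu) ?_)
  exact (contDiff_adjugate (fun _ _ => contDiff_entry _ _) _ _).contDiffOn

/-- A Hankel matrix which is tangent to the matrices of rank at most `k` at `A` vanishes as soon as
the first `2 * k` terms of its sequence do. -/
theorem eq_zero_of_fderiv_skeleton {N k : ℕ} (hkN : k < N) {A H : Matrix (Fin N) (Fin N) ℂ}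
    (hdet : (A.submatrix (Fin.castLE hkN.le) (Fin.castLE hkN.le)).det ≠ 0)
    (hH : H ∈ hankelSet N) (hD : fderiv ℝ (skeleton hkN.le) A H = H)
    (h0 : ∀ m < 2 * k, antidiagonalSeq H m = 0) : H = 0 := by
  have hd : HasFDerivAt (skeleton hkN.le) (fderiv ℝ (skeleton hkN.le) A) A :=
    (((contDiffOn_skeleton hkN.le).contDiffAt
      ((isOpen_leading_det_ne_zero hkN.le).mem_nhds hdet)).differentiableAt (by simp)).hasFDerivAt
  have hHg : hankelMat N (antidiagonalSeq H) = H := hankelMat_antidiagonalSeq hH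
  have hentry : ∀ j l : Fin N, H j l = antidiagonalSeq H (j.1 + l.1) := fun j l => by
    conv_lhs => rw [← hHg]
    rfl
  have key : ∀ m < 2 * N - 1, antidiagonalSeq H m = 0 := by
    intro m
    induction m using Nat.strong_induction_on with
    | _ m ih =>
      intro hm
      by_cases hmk : m < 2 * k
      · exact h0 m hmk
      -- Each antidiagonal `m ≥ 2 * k` has an entry outside the first `k` rows and columns.
      · obtain ⟨j, l, hj, hl, hjl⟩ : ∃ j l : Fin N, k ≤ j.1 ∧ k ≤ l.1 ∧ j.1 + l.1 = m :=
          ⟨⟨min (m - k) (N - 1), by omega⟩, ⟨m - min (m - k) (N - 1), by omega⟩, by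
            simp only; omega, by simp only; omega, by simp only; omega⟩
        have hline : HasDerivAt (fun t : ℝ => A + t • H) H 0 :=
          (((hasDerivAt_id (0 : ℝ)).smul_const H).const_add A).congr_deriv (one_smul ℝ H)
        have hd' : HasFDerivAt (skeleton hkN.le) (fderiv ℝ (skeleton hkN.le) A)
            (A + (0 : ℝ) • H) := by simpa using hd
        have h1 := ((entryCLM j l).hasFDerivAt.comp_hasDerivAt (0 : ℝ)
          (hd'.comp_hasDerivAt (0 : ℝ) hline)).congr_deriv (congrArg (entryCLM j l) hD)
        -- This entry of the skeleton involves only the leading block and parts of row `j` and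
        -- column `l` on earlier antidiagonals, where `H` vanishes.
        have hconst : (entryCLM j l ∘ skeleton hkN.le ∘ fun t : ℝ => A + t • H) =
            fun _ => skeleton hkN.le A j l := by
          ext t
          simp only [Function.comp_apply, entryCLM_apply, skeleton]
          have hP : (A + t • H).submatrix (Fin.castLE hkN.le) (Fin.castLE hkN.le) =
              A.submatrix (Fin.castLE hkN.le) (Fin.castLE hkN.le) := by
            ext i i'
            have : H (Fin.castLE hkN.le i) (Fin.castLE hkN.le i') = 0 := by
              rw [hentry]; exact h0 _ (by simp only [Fin.val_castLE]; omega)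
            simp [this]
          have hC : ∀ i : Fin k, H j (Fin.castLE hkN.le i) = 0 := fun i => by
            rw [hentry]
            exact ih _ (by simp only [Fin.val_castLE]; omega) (by simp only [Fin.val_castLE]; omega)
          have hR : ∀ i : Fin k, H (Fin.castLE hkN.le i) l = 0 := fun i => by
            rw [hentry]
            exact ih _ (by simp only [Fin.val_castLE]; omega) (by simp only [Fin.val_castLE]; omega)
          rw [hP]
          simp [Matrix.mul_apply, hC, hR]
        have h2 : HasDerivAt (fun _ : ℝ => skeleton hkN.le A j l) (H j l) 0 := by
          rw [← hconst]; exact h1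
        rw [← hjl, ← hentry]
        exact h2.unique (hasDerivAt_const _ _)
  ext j l
  rw [hentry]
  exact key _ (by omega)

/-- This is the clean intersection. The derivative of the chart retraction maps `H` to a Hankel
direction, tangent to the rank set, with the same first `2 * k` terms; `eq_zero_of_fderiv_skeleton`
kills the difference. -/
theorem fderiv_hankelChart_eq {N k : ℕ} (hkN : k < N) {A H : Matrix (Fin N) (Fin N) ℂ}
    (hA : A ∈ hankelStratum N k k) (hH : H ∈ hankelSet N)
    (hD : fderiv ℝ (skeleton hkN.le) A H = H) :
    fderiv ℝ (fun M => hankelChart N k k (coordMap N k k M)) A H = H := by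
  have hAR := hA.2 ▸ hankelChart_mem (N := N) hA.1
  have hext : ∀ M : Matrix (Fin N) (Fin N) ℂ, ∀ m < 2 * k,
      extendSeq (coordMap N k k M) m = antidiagonalSeq M m :=
    fun M m hm => extendSeq_coordMap le_rfl M hm
  have hdet : (A.submatrix (Fin.castLE hkN.le) (Fin.castLE hkN.le)).det ≠ 0 := by
    rw [submatrix_eq_hankelMat hkN hAR.2, ← hankelMat_congr (hext A)]
    exact hA.1
  set rS := fun M : Matrix (Fin N) (Fin N) ℂ => hankelChart N k k (coordMap N k k M) with hrS
  have hOpen : IsOpen (coordMap N k k ⁻¹' {u | (hankelMat k (extendSeq u)).det ≠ 0}) :=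
    (isOpen_det_ne_zero k k).preimage (coordMap N k k).continuous
  have hcd : ContDiffOn ℝ ∞ rS (coordMap N k k ⁻¹' {u | (hankelMat k (extendSeq u)).det ≠ 0}) :=
    contDiffOn_hankelChart.comp (coordMap N k k).contDiff.contDiffOn fun y hy => hy
  have hdS : HasFDerivAt rS (fderiv ℝ rS A) A :=
    ((hcd.contDiffAt (hOpen.mem_nhds hA.1)).differentiableAt (by simp)).hasFDerivAt
  have hdR : HasFDerivAt (skeleton hkN.le) (fderiv ℝ (skeleton hkN.le) (rS A)) (rS A) := by
    rw [show rS A = A from hA.2]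
    exact (((contDiffOn_skeleton hkN.le).contDiffAt
      ((isOpen_leading_det_ne_zero hkN.le).mem_nhds hdet)).differentiableAt (by simp)).hasFDerivAt
  set H' := fderiv ℝ rS A H with hH'
  have hH'mem : H' ∈ hankelSet N := by
    intro j l j' l' hjl
    have h1 : (entryCLM j l ∘ rS) = entryCLM j' l' ∘ rS := by
      ext M
      exact hankelMat_mem_hankelSet _ j l j' l' hjl
    have h2 := (entryCLM j l).hasFDerivAt.comp A hdS
    rw [h1] at h2
    exact DFunLike.congr_fun (h2.unique ((entryCLM j' l').hasFDerivAt.comp A hdS)) H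
  have hDH' : fderiv ℝ (skeleton hkN.le) A H' = H' := by
    have h1 : skeleton hkN.le ∘ rS =ᶠ[𝓝 A] rS := by
      filter_upwards [hOpen.mem_nhds hA.1] with M hM
      have hmem := hankelChart_mem (N := N) hM
      refine skeleton_eq_self hkN.le hmem.1 ?_
      rw [submatrix_eq_hankelMat hkN hmem.2, ← hankelMat_congr (hext _),
        coordMap_hankelChart le_rfl hkN]
      exact hM
    have h2 := (hdS.congr_of_eventuallyEq h1).unique (hdR.comp A hdS)
    rw [show rS A = A from hA.2] at h2
    exact (DFunLike.congr_fun h2 H).symm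
  have hπ : coordMap N k k H' = coordMap N k k H := by
    have h1 : coordMap N k k ∘ rS = coordMap N k k := by
      ext1 M
      exact coordMap_hankelChart le_rfl hkN _
    have h2 := (coordMap N k k).hasFDerivAt.comp A hdS
    rw [h1] at h2
    exact (DFunLike.congr_fun ((coordMap N k k).hasFDerivAt.unique h2) H).symm
  have hsub : H - H' ∈ hankelSet N := fun j l j' l' hjl => by
    simp only [Matrix.sub_apply]
    rw [hH j l j' l' hjl, hH'mem j l j' l' hjl]
  have hz := eq_zero_of_fderiv_skeleton hkN hdet hsub (by rw [map_sub, hD, hDH']) fun m hm => by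
    rw [← hext _ m hm, map_sub, hπ, sub_self]
    simp [extendSeq]
  exact (sub_eq_zero.1 hz).symm

end Rank

/-! ### Passage from the weighted norm to a Euclidean space. -/

section Transport

theorem isLocalRetraction_conj {V E : Type*} [NormedAddCommGroup V] [NormedSpace ℝ V]
    [NormedAddCommGroup E] [InnerProductSpace ℝ E] (e : V ≃L[ℝ] E) {r : V → V} {S : Set V} {a : V}
    (hr : ContDiffAt ℝ 2 r a) (hmem : ∀ᶠ x in 𝓝 a, r x ∈ S) (hfix : ∀ᶠ x in 𝓝 a, x ∈ S → r x = x) :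
    IsLocalRetraction (fun y => e (r (e.symm y))) (e.symm ⁻¹' S) (e a) := by
  have ht : Tendsto e.symm (𝓝 (e a)) (𝓝 a) := by
    simpa using e.symm.continuous.tendsto (e a)
  refine ⟨?_, ?_, ?_⟩
  · have h1 : ContDiffAt ℝ 2 r (e.symm (e a)) := by simpa using hr
    exact e.contDiff.contDiffAt.comp _ (h1.comp _ e.symm.contDiff.contDiffAt)
  · filter_upwards [ht.eventually hmem] with y hy
    simpa using hy
  · filter_upwards [ht.eventually hfix] with y hy hyS
    rw [hy hyS, e.apply_symm_apply]

theorem fderiv_conj {V E : Type*} [NormedAddCommGroup V] [NormedSpace ℝ V]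
    [NormedAddCommGroup E] [NormedSpace ℝ E] (e : V ≃L[ℝ] E) {r : V → V} {a : V}
    (hr : DifferentiableAt ℝ r a) (h : E) :
    fderiv ℝ (fun y => e (r (e.symm y))) (e a) h = e (fderiv ℝ r a (e.symm h)) := by
  have h1 : HasFDerivAt r (fderiv ℝ r a) (e.symm (e a)) := by simpa using hr.hasFDerivAt
  have h2 := e.hasFDerivAt.comp (e a) (h1.comp (e a) e.symm.hasFDerivAt)
  have h3 : fderiv ℝ (fun y => e (r (e.symm y))) (e a) = _ := h2.fderiv
  rw [h3]
  rfl

/-- The Hankel matrices as a real vector space. -/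
def hankelSubmodule (N : ℕ) : Submodule ℝ (Matrix (Fin N) (Fin N) ℂ) where
  carrier := hankelSet N
  zero_mem' := fun _ _ _ _ _ => rfl
  add_mem' := fun {A B} hA hB j l j' l' h => by
    rw [Matrix.add_apply, Matrix.add_apply, hA j l j' l' h, hB j l j' l' h]
  smul_mem' := fun c A hA j l j' l' h => by
    rw [Matrix.smul_apply, Matrix.smul_apply, hA j l j' l' h]

/-- The rescaling of the entries which turns the weighted norm into the Euclidean one. -/
noncomputable def weightEquiv {N : ℕ} (w : Fin N → ℝ) (hw : ∀ j, 0 < w j) :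
    Matrix (Fin N) (Fin N) ℂ ≃L[ℝ] EuclideanSpace ℂ (Fin N × Fin N) :=
  LinearEquiv.toContinuousLinearEquiv
    { toFun := fun A => WithLp.toLp 2 fun p => (√(w p.1 * w p.2) : ℝ) • A p.1 p.2
      invFun := fun x => Matrix.of fun j l => (√(w j * w l))⁻¹ • x (j, l)
      map_add' := fun A B => by ext p; simp
      map_smul' := fun c A => by ext p; simp [mul_left_comm]
      left_inv := fun A => by
        ext j l
        have : √(w j * w l) ≠ 0 := (Real.sqrt_pos.2 (mul_pos (hw j) (hw l))).ne'
        simp only [Matrix.of_apply]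
        rw [inv_smul_smul₀ this]
      right_inv := fun x => by
        ext p
        have : √(w p.1 * w p.2) ≠ 0 := (Real.sqrt_pos.2 (mul_pos (hw p.1) (hw p.2))).ne'
        simp only [Matrix.of_apply]
        rw [smul_inv_smul₀ this] }

theorem norm_weightEquiv {N : ℕ} (w : Fin N → ℝ) (hw : ∀ j, 0 < w j)
    (A : Matrix (Fin N) (Fin N) ℂ) : ‖weightEquiv w hw A‖ = weightedNorm w A := by
  rw [EuclideanSpace.norm_eq, weightedNorm, Fintype.sum_prod_type]
  congr 1
  refine Finset.sum_congr rfl fun j _ => Finset.sum_congr rfl fun l _ => ?_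
  change ‖(√(w j * w l) : ℝ) • A j l‖ ^ 2 = _
  rw [norm_smul, mul_pow, Real.norm_eq_abs, sq_abs, Real.sq_sqrt (mul_pos (hw j) (hw l)).le]
  ring

theorem isProjection_of_isUniqueNearest {N : ℕ} {w : Fin N → ℝ} (hw : ∀ j, 0 < w j)
    {S : Set (Matrix (Fin N) (Fin N) ℂ)} {b p : EuclideanSpace ℂ (Fin N × Fin N)}
    (h : IsUniqueNearest ((weightEquiv w hw).symm ⁻¹' S) b p) :
    IsProjection w S ((weightEquiv w hw).symm b) ((weightEquiv w hw).symm p) := by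
  refine ⟨h.1, fun Q hQ hne => ?_⟩
  have h1 := h.2 (weightEquiv w hw Q) (by simpa using hQ) (by
    rintro rfl
    simp at hne)
  rw [← norm_weightEquiv w hw, ← norm_weightEquiv w hw]
  simpa using h1

end Transport

theorem theorem7 (N k : ℕ) (hk : 1 ≤ k) (hkN : k < N) (w : Fin N → ℝ) (hw : ∀ j, 0 < w j) :
    ∃ T : Set (Matrix (Fin N) (Fin N) ℂ),
      T ⊆ rankSet N k ∩ hankelSet N ∧
      IsThinRelativeTo T (genericHankelSet hkN) ∧
      ∀ A ∈ rankSet N k ∩ hankelSet N, A ∉ T →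
        ∀ ε : ℝ, 0 < ε → ∃ s : ℝ, 0 < s ∧
          ∀ f : Fin (2 * N - 1) → ℂ, weightedNorm w (hankel f - A) ≤ s →
            ∃ (B : ℕ → Matrix (Fin N) (Fin N) ℂ) (fopt finf : Fin (2 * N - 1) → ℂ),
              IsAlternatingProjectionSeq w k (hankel f) B ∧
              IsProjection w (rankSet N k ∩ hankelSet N) (hankel f) (hankel fopt) ∧
              Tendsto (fun j => weightedNorm w (B j - hankel finf)) atTop (𝓝 0) ∧
              hankel finf ∈ genericHankelSet hkN ∧
              weightedNorm w (hankel finf - hankel fopt) ≤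
                ε * weightedNorm w (hankel f - hankel fopt) := by
  refine ⟨_, Set.sdiff_subset, isThinRelativeTo_nongeneric hk hkN, ?_⟩
  intro A hA hAT ε hε
  have hAgen : A ∈ genericHankelSet hkN := by
    by_contra h
    exact hAT ⟨hA, h⟩
  rw [genericHankelSet_eq hkN] at hAgen
  have hAstr : A ∈ hankelStratum N k k := ⟨hAgen.1.1, hAgen.2⟩
  have hext : ∀ M : Matrix (Fin N) (Fin N) ℂ, ∀ m < 2 * k,
      extendSeq (coordMap N k k M) m = antidiagonalSeq M m :=
    fun M m hm => extendSeq_coordMap le_rfl M hm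
  have hdet : (A.submatrix (Fin.castLE hkN.le) (Fin.castLE hkN.le)).det ≠ 0 := by
    rw [submatrix_eq_hankelMat hkN hA.2, ← hankelMat_congr (hext A)]
    exact hAstr.1
  let e := weightEquiv w hw
  let rS : Matrix (Fin N) (Fin N) ℂ → Matrix (Fin N) (Fin N) ℂ :=
    fun M => hankelChart N k k (coordMap N k k M)
  let L : Submodule ℝ (EuclideanSpace ℂ (Fin N × Fin N)) :=
    (hankelSubmodule N).comap (e.symm : EuclideanSpace ℂ (Fin N × Fin N) →ₗ[ℝ] _)
  let R : Set (EuclideanSpace ℂ (Fin N × Fin N)) := e.symm ⁻¹' rankSet N k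
  have hOpen : IsOpen (coordMap N k k ⁻¹' {u | (hankelMat k (extendSeq u)).det ≠ 0}) :=
    (isOpen_det_ne_zero k k).preimage (coordMap N k k).continuous
  have hcdS : ContDiffAt ℝ ∞ rS A :=
    (contDiffOn_hankelChart.comp (coordMap N k k).contDiff.contDiffOn
      fun y hy => hy : ContDiffOn ℝ ∞ rS _).contDiffAt (hOpen.mem_nhds hAstr.1)
  have hcdR : ContDiffAt ℝ ∞ (skeleton hkN.le) A := (contDiffOn_skeleton hkN.le).contDiffAt
    ((isOpen_leading_det_ne_zero hkN.le).mem_nhds hdet)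
  have hR : IsLocalRetraction (fun y => e (skeleton hkN.le (e.symm y))) R (e A) := by
    refine isLocalRetraction_conj e (hcdR.of_le (WithTop.coe_le_coe.2 (le_top : (2 : ℕ∞) ≤ ⊤)))
      (Eventually.of_forall (skeleton_mem_rankSet hkN.le)) ?_
    filter_upwards [(isOpen_leading_det_ne_zero hkN.le).mem_nhds hdet] with M hM hMR
    exact skeleton_eq_self hkN.le hMR hM
  have hS : IsLocalRetraction (fun y => e (rS (e.symm y))) (R ∩ L) (e A) := by
    refine isLocalRetraction_conj e (S := rankSet N k ∩ hankelSet N)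
      (hcdS.of_le (WithTop.coe_le_coe.2 (le_top : (2 : ℕ∞) ≤ ⊤))) ?_ ?_
    · filter_upwards [hOpen.mem_nhds hAstr.1] with M hM using hankelChart_mem hM
    · filter_upwards [hOpen.mem_nhds hAstr.1] with M hM hMS
      refine (mem_stratum_of_det_ne_zero hkN hMS ?_).2
      rw [← hankelMat_congr (hext M)]
      exact hM
  have htan : ∀ h ∈ L, fderiv ℝ (fun y => e (skeleton hkN.le (e.symm y))) (e A) h = h →
      fderiv ℝ (fun y => e (rS (e.symm y))) (e A) h = h := by
    intro h hL hh
    have hd : fderiv ℝ (skeleton hkN.le) A (e.symm h) = e.symm h := by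
      rw [← e.symm_apply_apply (fderiv ℝ (skeleton hkN.le) A (e.symm h))]
      exact congrArg e.symm
        ((fderiv_conj e (hcdR.differentiableAt (by simp)) h).symm.trans hh)
    refine (fderiv_conj e (hcdS.differentiableAt (by simp)) h).trans ?_
    have hL' : e.symm h ∈ hankelSet N := hL
    exact (congrArg e (fderiv_hankelChart_eq hkN hAstr hL' hd)).trans (e.apply_symm_apply h)
  have hRc : IsClosed R := (isClosed_rankSet N k).preimage e.symm.continuous
  have hmemR : ∀ M, e M ∈ R ↔ M ∈ rankSet N k := fun M => by simp [R]
  have hmemL : ∀ M, e M ∈ L ↔ M ∈ hankelSet N := fun M => by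
    change e.symm (e M) ∈ hankelSet N ↔ _
    rw [e.symm_apply_apply]
  -- Genericity is open in the coordinates; this neighbourhood forces the limit to be generic.
  have hW : e.symm ⁻¹' (coordMap N k k ⁻¹' {u : Fin (k + k) → ℂ |
      (hankelMat k (extendSeq u)).det ≠ 0 ∧ MvPolynomial.eval u (genericityPoly k) ≠ 0}) ∈
      𝓝 (e A) := by
    refine (((isOpen_generic k).preimage (coordMap N k k).continuous).preimage
      e.symm.continuous).mem_nhds ?_
    simpa using hAgen.1
  obtain ⟨s, hs, hmain⟩ := alternatingProjections hRc ((hmemR A).2 hA.1) ((hmemL A).2 hA.2) hR hS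
    htan hε hW
  refine ⟨s, hs, fun f hf => ?_⟩
  have hfH : hankel f ∈ hankelSet N := hankel_eq_hankelMat f ▸ hankelMat_mem_hankelSet _
  obtain ⟨B, p, x, hB0, hB, hp, hx, hxS, hxW, hxp⟩ := hmain (e (hankel f)) ((hmemL _).2 hfH) (by
    rw [← map_sub]
    exact (norm_weightEquiv w hw _).trans_le hf)
  have hseq : ∀ M ∈ hankelSet N, hankel (fun i : Fin (2 * N - 1) => antidiagonalSeq M i.1) = M :=
    fun M hM => by
      conv_rhs => rw [← hankelMat_antidiagonalSeq hM]
      rfl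
  have hnorm : ∀ y z, weightedNorm w (e.symm y - e.symm z) = ‖y - z‖ := fun y z => by
    rw [← norm_weightEquiv w hw, ← map_sub]
    exact congrArg norm (e.apply_symm_apply _)
  have hef : e.symm (e (hankel f)) = hankel f := e.symm_apply_apply _
  have hpH : e.symm p ∈ hankelSet N := hp.1.2
  have hxH : e.symm x ∈ hankelSet N := hxS.2
  refine ⟨fun j => e.symm (B j), fun i => antidiagonalSeq (e.symm p) i.1,
    fun i => antidiagonalSeq (e.symm x) i.1, ⟨?_, fun j => ⟨fun hj => ?_, fun hj => ?_⟩⟩,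
    ?_, ?_, ?_, ?_⟩
  · exact (congrArg e.symm hB0).trans hef
  · exact isProjection_of_isUniqueNearest hw ((hB j).1 hj)
  · exact isProjection_of_isUniqueNearest hw ((hB j).2 hj)
  · rw [hseq _ hpH, ← hef]
    exact isProjection_of_isUniqueNearest hw hp
  · rw [hseq _ hxH]
    simp only [hnorm]
    exact tendsto_iff_norm_sub_tendsto_zero.1 hx
  · rw [hseq _ hxH, genericHankelSet_eq hkN]
    refine ⟨hxW, (mem_stratum_of_det_ne_zero hkN hxS ?_).2⟩
    rw [← hankelMat_congr (hext _)]
    exact hxW.1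
  · rw [hseq _ hxH, hseq _ hpH, ← hef, hnorm, hnorm]
    exact hxp
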